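/- Let $G$ be a finite connected simple graph with $n_V$ vertices and $n_E$ edges, each edge being given a direction, and let $u\in\mathbb{C}$, $u\neq 1$. Let $\zeta_G(q,u)$ be the Bartholdi zeta function $$\zeta_G(q,u)=\prod_{C}\frac{1}{1-q^{|C|}u^{b(C)}},$$ where $C$ runs over the primitive cycles of $G$ up to cyclic rotation (cycles are closed sequences of directed edges, each edge of $G$ may be used in both directions, and backtracking is allowed), $|C|$ is the length of $C$, and $b(C)$ is its number of bumps, i.e. of cyclically consecutive pairs $\boldsymbol{e},\boldsymbol{e}^{-1}$. For fixed $u$ the product converges for all sufficiently small $q$, and it has a meromorphic continuation in $q$ to $\mathbb{C}$, again denoted $\zeta_G(q,u)$. Put $u_*=1-\frac{n_E}{n_V}$, let $\vec d=(\deg v)_{v\in V}$ be the degree vector, let $L$ be the $n_E\times n_V$ incidence matrix ($L_{ev}=1$ if $v$ is the target of $e$, $-1$ if $v$ is the source of $e$, $0$ otherwise), and let $L^+$ be its Moore–Penrose inverse. 1. If $G$ is not bipartite and $n_E>n_V$, then $q=-(1-u)^{-1}$ is a pole of $\zeta_G(q,u)$ of order $n_E-n_V$. If $G$ is not bipartite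 and $n_E=n_V$, then $q=-(1-u)^{-1}$ is not a pole. 2. If $G$ is bipartite, then $\zeta_G(q,u)$ is even in $q$, so that its order at $q=-(1-u)^{-1}$ equals its order at $q=(1-u)^{-1}$. 3. If $G$ is bipartite and not a tree, then $q=-(1-u)^{-1}$ is a pole of order $n_E-n_V+1$ if $u\neq u_*$, and it is a pole of order at least $n_E-n_V+2$ if and only if $u=u_*$. 4. If $G$ is a tree, then $q=-(1-u)^{-1}$ is a pole if and only if $u=u_*$. 5. If $G$ is bipartite (possibly a tree), $|(L^+)^T\vec d|^2\neq n_E$ and $u=u_*$, then $q=-(1-u)^{-1}$ is a pole of order exactly $n_E-n_V+2$. -/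

import Mathlib

open Filter Topology Matrix

namespace BartholdiZeta

section Cycles

variable {V : Type*} (G : SimpleGraph V)

/-- A cycle of `G` up to cyclic rotation. The doubled edge set `E_D`, which contains both
directions of each edge, is `G.Dart`, and the inverse of `e` is `e.symm`. A class is a nonempty
list of directed edges modulo rotation (Mathlib's `Cycle`), in which the target of each directed
edge is the source of the next one, the last being followed by the first. -/
def IsCycleClass (c : Cycle G.Dart) : Prop :=
  c ≠ Cycle.nil ∧ c.Chain G.DartAdj

/-- A cycle (class) is primitive when it is not a proper power `C' ^ r`, `r ≥ 2`, of a cycle. -/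
def IsPrimitive (c : Cycle G.Dart) : Prop :=
  ∀ (l : List G.Dart) (r : ℕ), IsCycleClass G (l : Cycle G.Dart) → 2 ≤ r →
    c ≠ ((List.replicate r l).flatten : Cycle G.Dart)

/-- The type of rotation classes of primitive cycles of `G`. -/
def PrimitiveCycle : Type _ :=
  {c : Cycle G.Dart // IsCycleClass G c ∧ IsPrimitive G c}

variable {G} [DecidableEq V]

/-- The number of bumps of the cycle `e₁ ⋯ e_l`: the number of positions `j` (mod `l`) with
`e_{j+1} = e_j⁻¹`, so that backtrackings and the tail are both counted. -/
def listBumps (l : List G.Dart) : ℕ :=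
  (List.zipWith (fun e f : G.Dart => decide (f = e.symm)) l (l.rotate 1)).count true

theorem listBumps_rotate (l : List G.Dart) (n : ℕ) : listBumps (l.rotate n) = listBumps l := by
  unfold listBumps
  rw [List.rotate_rotate, Nat.add_comm, ← List.rotate_rotate,
    ← List.zipWith_rotate_distrib _ _ _ _ (by simp)]
  exact (List.rotate_perm _ _).count_eq _

/-- The number of bumps of a cycle class. -/
def bumps (c : Cycle G.Dart) : ℕ :=
  Quotient.liftOn' c listBumps (by
    rintro l l' ⟨n, rfl⟩
    exact (listBumps_rotate l n).symm)

/-- `Z` is the Bartholdi zeta function `q ↦ ζ_G(q, u)` on the whole complex plane: it is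
meromorphic on `ℂ`, and for all sufficiently small `q` it is the value of the (unconditionally
convergent) Euler product of `1 / (1 - q ^ |C| * u ^ b(C))` over the classes `C` of primitive
cycles. By the identity theorem two such functions agree off a discrete closed set. -/
def IsBartholdiZeta (G : SimpleGraph V) (u : ℂ) (Z : ℂ → ℂ) : Prop :=
  MeromorphicOn Z Set.univ ∧
    ∀ᶠ q in 𝓝 (0 : ℂ),
      HasProd (fun C : PrimitiveCycle G => 1 / (1 - q ^ C.1.length * u ^ bumps C.1)) (Z q)

end Cycles

section Poles

/-- `z` is a pole of `f` (a function meromorphic at `z`). -/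
def IsPole (f : ℂ → ℂ) (z : ℂ) : Prop :=
  MeromorphicAt f z ∧ meromorphicOrderAt f z < 0

/-- `z` is a pole of `f` of order exactly `k`. -/
def IsPoleOfOrder (f : ℂ → ℂ) (z : ℂ) (k : ℤ) : Prop :=
  IsPole f z ∧ meromorphicOrderAt f z = ((-k : ℤ) : WithTop ℤ)

/-- `z` is a pole of `f` of order at least `k`. -/
def IsPoleOfOrderAtLeast (f : ℂ → ℂ) (z : ℂ) (k : ℤ) : Prop :=
  IsPole f z ∧ meromorphicOrderAt f z ≤ ((-k : ℤ) : WithTop ℤ)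

end Poles

section MoorePenrose

/-- The four Penrose conditions: `P` is the Moore-Penrose inverse of the real matrix `M`. -/
structure IsMoorePenroseInverse {m n : Type*} [Fintype m] [Fintype n]
    (M : Matrix m n ℝ) (P : Matrix n m ℝ) : Prop where
  mul_mul_self : M * P * M = M
  self_mul_mul : P * M * P = P
  symm_left : (P * M)ᵀ = P * M
  symm_right : (M * P)ᵀ = M * P

theorem IsMoorePenroseInverse.unique {m n : Type*} [Fintype m] [Fintype n]
    {M : Matrix m n ℝ} {P Q : Matrix n m ℝ}
    (hP : IsMoorePenroseInverse M P) (hQ : IsMoorePenroseInverse M Q) : P = Q := by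
  have h1 : M * P = M * Q := by
    calc M * P = (M * P)ᵀ := hP.symm_right.symm
      _ = ((M * Q * M) * P)ᵀ := by rw [hQ.mul_mul_self]
      _ = ((M * Q) * (M * P))ᵀ := by simp only [Matrix.mul_assoc]
      _ = (M * P) * (M * Q) := by rw [Matrix.transpose_mul, hP.symm_right, hQ.symm_right]
      _ = (M * P * M) * Q := by simp only [Matrix.mul_assoc]
      _ = M * Q := by rw [hP.mul_mul_self]
  have h2 : P * M = Q * M := by
    calc P * M = (P * M)ᵀ := hP.symm_left.symm
      _ = (P * (M * Q * M))ᵀ := by rw [hQ.mul_mul_self]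
      _ = ((P * M) * (Q * M))ᵀ := by simp only [Matrix.mul_assoc]
      _ = (Q * M) * (P * M) := by rw [Matrix.transpose_mul, hP.symm_left, hQ.symm_left]
      _ = Q * (M * P * M) := by simp only [Matrix.mul_assoc]
      _ = Q * M := by rw [hP.mul_mul_self]
  calc P = P * M * P := hP.self_mul_mul.symm
    _ = Q * (M * P) := by rw [h2, Matrix.mul_assoc]
    _ = Q * M * Q := by rw [h1, Matrix.mul_assoc]
    _ = Q := hQ.self_mul_mul

theorem exists_isMoorePenroseInverse {m n : Type*} [Fintype m] [Fintype n]
    (M : Matrix m n ℝ) : ∃ P, IsMoorePenroseInverse M P := by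
  classical
  have hH : (Mᵀ * M).IsHermitian := by
    simpa [Matrix.conjTranspose_eq_transpose_of_trivial] using
      Matrix.isHermitian_conjTranspose_mul_self M
  obtain ⟨K, hK1, hK2, hK3⟩ : ∃ K : Matrix n n ℝ, Kᵀ = K ∧ (Mᵀ * M) * K * (Mᵀ * M) = Mᵀ * M ∧
      K * (Mᵀ * M) * K = K ∧ K * (Mᵀ * M) = (Mᵀ * M) * K := by
    set U : Matrix n n ℝ := (hH.eigenvectorUnitary : Matrix n n ℝ) with hU
    have hUU : Uᵀ * U = 1 := by
      have := Unitary.coe_star_mul_self hH.eigenvectorUnitary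
      simpa [Matrix.star_eq_conjTranspose, Matrix.conjTranspose_eq_transpose_of_trivial] using this
    set d := hH.eigenvalues with hd
    have hs : Mᵀ * M = U * diagonal d * Uᵀ := by
      have := hH.spectral_theorem
      rw [Unitary.conjStarAlgAut_apply] at this
      simpa [Matrix.star_eq_conjTranspose, Matrix.conjTranspose_eq_transpose_of_trivial,
        Function.comp_def] using this
    have key : ∀ a b : n → ℝ, (U * diagonal a * Uᵀ) * (U * diagonal b * Uᵀ) =
        U * diagonal (fun i => a i * b i) * Uᵀ := by
      intro a b
      calc _ = U * diagonal a * (Uᵀ * U) * diagonal b * Uᵀ := by simp only [Matrix.mul_assoc]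
        _ = U * (diagonal a * diagonal b) * Uᵀ := by
          rw [hUU, Matrix.mul_one]; simp only [Matrix.mul_assoc]
        _ = _ := by rw [diagonal_mul_diagonal]
    refine ⟨U * diagonal (fun i => (d i)⁻¹) * Uᵀ, ?_, ?_, ?_, ?_⟩
    · simp [Matrix.transpose_mul, Matrix.mul_assoc]
    · rw [hs, key, key]
      congr 3
      funext i
      exact mul_inv_mul_cancel (d i)
    · rw [hs, key, key]
      congr 3
      funext i
      simpa using mul_inv_mul_cancel (d i)⁻¹
    · rw [hs, key, key]
      congr 3
      funext i
      exact mul_comm _ _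
  obtain ⟨hK3, hK4⟩ := hK3
  refine ⟨K * Mᵀ, ?_, ?_, ?_, ?_⟩
  · have h0 : (M * K * Mᵀ * M - M)ᵀ * (M * K * Mᵀ * M - M) = 0 := by
      have e : M * K * Mᵀ * M - M = M * (K * (Mᵀ * M) - 1) := by
        rw [Matrix.mul_sub, Matrix.mul_one]; simp only [Matrix.mul_assoc]
      have e2 : Mᵀ * M * (K * (Mᵀ * M) - 1) = 0 := by
        rw [Matrix.mul_sub, Matrix.mul_one, ← Matrix.mul_assoc, hK2, sub_self]
      rw [e, Matrix.transpose_mul, Matrix.mul_assoc, ← Matrix.mul_assoc Mᵀ, e2, Matrix.mul_zero]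
    have h1 := (Matrix.conjTranspose_mul_self_eq_zero (A := M * K * Mᵀ * M - M)).1
      (by simpa only [Matrix.conjTranspose_eq_transpose_of_trivial] using h0)
    simpa only [Matrix.mul_assoc] using sub_eq_zero.1 h1
  · calc K * Mᵀ * M * (K * Mᵀ) = (K * (Mᵀ * M) * K) * Mᵀ := by simp only [Matrix.mul_assoc]
      _ = K * Mᵀ := by rw [hK3]
  · rw [Matrix.mul_assoc, Matrix.transpose_mul, hK1, Matrix.transpose_mul,
      Matrix.transpose_transpose, hK4]
  · simp only [Matrix.transpose_mul, hK1, Matrix.transpose_transpose, Matrix.mul_assoc]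

/-- The Moore-Penrose inverse `M⁺` of a real matrix. -/
noncomputable def moorePenrose {m n : Type*} [Fintype m] [Fintype n]
    (M : Matrix m n ℝ) : Matrix n m ℝ :=
  Classical.choose (exists_isMoorePenroseInverse M)

theorem moorePenrose_spec {m n : Type*} [Fintype m] [Fintype n] (M : Matrix m n ℝ) :
    IsMoorePenroseInverse M (moorePenrose M) :=
  Classical.choose_spec (exists_isMoorePenroseInverse M)

end MoorePenrose

section GraphMatrices

variable {V : Type*} (G : SimpleGraph V)

/-- A choice of direction for each edge of the simple graph `G`, which makes it a simple directed
graph: `dart e` is the directed edge `⟨s(e), t(e)⟩`. -/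
structure EdgeDirection where
  dart : G.edgeSet → G.Dart
  edge_dart : ∀ e, (dart e).edge = e.1

variable {G}

/-- The incidence matrix `L`: `L e v` is `1` if `v = t(e)`, `-1` if `v = s(e)`, `0` otherwise. -/
def incidence [DecidableEq V] (o : EdgeDirection G) : Matrix G.edgeSet V ℝ :=
  Matrix.of fun e v =>
    if v = (o.dart e).snd then 1 else if v = (o.dart e).fst then -1 else 0

variable (G) [Fintype V] [DecidableRel G.Adj]

/-- The degree vector of `G`. -/
def degreeVector : V → ℝ := fun v => (G.degree v : ℝ)

variable [DecidableEq V]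

/-- The number of vertices. -/
def nV (_G : SimpleGraph V) : ℕ := Fintype.card V

/-- The number of (undirected) edges. -/
def nE : ℕ := G.edgeFinset.card

/-- The critical value `u_* = 1 - n_E / n_V`. -/
noncomputable def uStar : ℂ := 1 - (nE G : ℂ) / (nV G : ℂ)

variable {G}

/-- The squared Euclidean norm `|(L⁺)ᵀ d|²` for the degree vector `d`. -/
noncomputable def normSqPinvDegree (o : EdgeDirection G) : ℝ :=
  ∑ e, ((moorePenrose (incidence o))ᵀ *ᵥ degreeVector G) e ^ 2

end GraphMatrices

end BartholdiZeta

/-! Write t = 1 - u and let W be the matrix on darts with entry 1 for a continuation without bump, u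
for a bump, and 0 otherwise. Near q = 0 the Euler product is 1 / det(1 - qW)
(`eventually_hasProd_inv_det`). Indeed -log det(1 - qW) = ∑ qᵏ tr(Wᵏ) / k is a weighted sum over
words of darts; every nonempty word is a unique power of an aperiodic word, and a primitive class of
length n has exactly n aperiodic representatives. The determinant is entire in q, so its inverse is
the continuation, and the identity theorem gives every other `Z` the same orders.

The Bass–Bartholdi formula `det_one_sub_smul_dartWeight` then reads det(1 - qW) = (1 - (tq)²)^(n_E -
n_V) · det(1 - qA + tq²(D - t)). At q = ±1/t the first factor has order n_E - n_V, so only the order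
m of the vertex determinant remains.

At q = -1/t the vertex matrix is (D + A)/t, a multiple of the signless Laplacian, which is
invertible when G is connected and not bipartite; thus m = 0. If G is bipartite, W is conjugate to
-W, so it suffices to study q = 1/t. With s = tq - 1 and Δ = D - A, t times the vertex matrix is Δ +
sB₁ + s²B₂, where B₁ = Δ + D - 2t and B₂ = D - t. The kernel of Δ consists of the constants, so the
determinant vanishes at s = 0, to first order exactly when 1ᵀB₁1 = 2(n_E - t n_V) ≠ 0, that is, u ≠
u_*. At u = u_*, solving Δz = -B₁1 reduces the next coefficient, up to a nonzero factor, to 1ᵀ(B₂1 +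
B₁z) = n_E - |(L⁺)ᵀd|². -/

namespace BartholdiZeta

/-! ### Traces of powers and the determinant of 1 - qA -/

section TracePowers

open Polynomial

variable {n : Type*} [Fintype n] [DecidableEq n]

/-- Both sides are multiplicative in `P`, which splits over ℂ. For a factor X - r the determinant is
the characteristic polynomial at r up to a sign (-1)ⁿ, absorbed by the n roots. -/
theorem det_aeval_eq_prod_roots_charpoly (A : Matrix n n ℂ) (P : ℂ[X]) :
    (aeval A P).det = (A.charpoly.roots.map fun x => P.eval x).prod := by
  have hcard : Multiset.card A.charpoly.roots = Fintype.card n := by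
    rw [← (IsAlgClosed.splits A.charpoly).natDegree_eq_card_roots, charpoly_natDegree_eq_dim]
  have hlin : ∀ r : ℂ, (aeval A (X - C r)).det =
      (A.charpoly.roots.map fun x => (X - C r).eval x).prod := by
    intro r
    have h1 : A.charpoly.eval r = (A.charpoly.roots.map fun x => r - x).prod := by
      conv_lhs => rw [(IsAlgClosed.splits A.charpoly).eq_prod_roots_of_monic (charpoly_monic A)]
      rw [eval_multiset_prod, Multiset.map_map]
      simp
    rw [eval_charpoly] at h1
    have h2 : aeval A (X - C r) = -(scalar n r - A) := by
      simp [Algebra.algebraMap_eq_smul_one, ← smul_one_eq_diagonal]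
    have h3 := Multiset.prod_map_neg (A.charpoly.roots.map fun x => r - x)
    rw [Multiset.card_map, hcard] at h3
    rw [h2, det_neg, h1, ← h3]
    simp [Multiset.map_map]
  have hprod : ∀ s : Multiset ℂ, (aeval A (s.map fun r => X - C r).prod).det =
      (A.charpoly.roots.map fun x => ((s.map fun r => X - C r).prod).eval x).prod := by
    intro s
    induction s using Multiset.induction_on with
    | empty => simp
    | cons r s ih =>
      rw [Multiset.map_cons, Multiset.prod_cons, map_mul, det_mul, hlin, ih,
        ← Multiset.prod_map_mul]
      simp only [eval_mul]
  rw [(IsAlgClosed.splits P).eq_prod_roots, map_mul, det_mul, hprod]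
  simp only [eval_mul, eval_C, Multiset.prod_map_mul, Multiset.map_const', Multiset.prod_replicate,
    hcard, aeval_C, Algebra.algebraMap_eq_smul_one, det_smul, det_one, mul_one]

theorem roots_charpoly_aeval (A : Matrix n n ℂ) (P : ℂ[X]) :
    (aeval A P).charpoly.roots = A.charpoly.roots.map fun x => P.eval x := by
  have : (aeval A P).charpoly = ((A.charpoly.roots.map fun x => P.eval x).map
      fun a => X - C a).prod := by
    apply Polynomial.funext
    intro c
    have h : scalar n c - aeval A P = aeval A (C c - P) := by
      simp [Algebra.algebraMap_eq_smul_one, ← smul_one_eq_diagonal]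
    rw [eval_charpoly, h, det_aeval_eq_prod_roots_charpoly, eval_multiset_prod, Multiset.map_map,
      Multiset.map_map]
    simp
  rw [this, roots_multiset_prod_X_sub_C]

theorem trace_pow_eq_sum_roots_charpoly (A : Matrix n n ℂ) (k : ℕ) :
    (A ^ k).trace = (A.charpoly.roots.map fun x => x ^ k).sum := by
  have := roots_charpoly_aeval A (X ^ k)
  simp only [map_pow, aeval_X, eval_pow, eval_X] at this
  rw [trace_eq_sum_roots_charpoly, this]

/-- Stated through `exp`, because a sum of principal logarithms need not be the principal logarithm
of the product. The term k = 0 vanishes, being a division by zero. -/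
theorem exists_hasSum_powerSum_div (s : Multiset ℂ) (q : ℂ) (h : ∀ x ∈ s, ‖q * x‖ < 1) :
    ∃ a, HasSum (fun k : ℕ => q ^ k * (s.map fun x => x ^ k).sum / k) a ∧
      Complex.exp (-a) = (s.map fun x => 1 - q * x).prod := by
  induction s using Multiset.induction_on with
  | empty => exact ⟨0, by simp [hasSum_zero], by simp⟩
  | cons x s ih =>
    obtain ⟨a, ha, ha'⟩ := ih fun y hy => h y (Multiset.mem_cons_of_mem hy)
    have hx := h x (Multiset.mem_cons_self x s)
    have hne : 1 - q * x ≠ 0 := by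
      intro h0
      rw [← sub_eq_zero.1 h0] at hx
      simp at hx
    refine ⟨-Complex.log (1 - q * x) + a, ?_, ?_⟩
    · convert! (Complex.hasSum_taylorSeries_neg_log hx).add ha using 2 with k
      rw [Multiset.map_cons, Multiset.sum_cons, mul_pow]
      ring
    · rw [neg_add, neg_neg, Complex.exp_add, Complex.exp_log hne, ha', Multiset.map_cons,
        Multiset.prod_cons]

/-- `det (1 - q A) = exp (-∑ q ^ k tr (A ^ k) / k)` for small `q`. -/
theorem eventually_hasSum_trace_pow (A : Matrix n n ℂ) :
    ∀ᶠ q in 𝓝 (0 : ℂ), ∃ a, HasSum (fun k : ℕ => q ^ k * (A ^ k).trace / k) a ∧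
      Complex.exp a = (det (1 - q • A))⁻¹ := by
  have hsmall : ∀ᶠ q in 𝓝 (0 : ℂ), ∀ x ∈ A.charpoly.roots.toFinset, ‖q * x‖ < 1 := by
    rw [Filter.eventually_all_finset]
    intro x _
    have : Tendsto (fun q : ℂ => ‖q * x‖) (𝓝 0) (𝓝 ‖(0 : ℂ) * x‖) := by
      apply Continuous.tendsto
      fun_prop
    exact this.eventually_lt_const (by simp)
  filter_upwards [hsmall] with q hq
  obtain ⟨a, ha, ha'⟩ := exists_hasSum_powerSum_div A.charpoly.roots q
    (fun x hx => hq x (Multiset.mem_toFinset.2 hx))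
  refine ⟨a, ?_, ?_⟩
  · simpa only [trace_pow_eq_sum_roots_charpoly] using ha
  · have h : (1 - q • A) = aeval A (1 - C q * X) := by
      simp [Algebra.algebraMap_eq_smul_one]
    rw [h, det_aeval_eq_prod_roots_charpoly, ← inv_inv (Complex.exp a), ← Complex.exp_neg, ha']
    simp

end TracePowers

/-! ### Words under rotation: periods and aperiodic roots -/

section CyclicWords

variable {D : Type*}

/-- The `m`-th power of a word. -/
def wordPow (l : List D) (m : ℕ) : List D := (List.replicate m l).flatten

@[simp] theorem wordPow_zero (l : List D) : wordPow l 0 = [] := rfl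

theorem wordPow_succ (l : List D) (m : ℕ) : wordPow l (m + 1) = l ++ wordPow l m := by
  simp [wordPow, List.replicate_succ]

@[simp] theorem wordPow_nil (m : ℕ) : wordPow ([] : List D) m = [] := by
  simp [wordPow]

@[simp] theorem length_wordPow (l : List D) (m : ℕ) : (wordPow l m).length = m * l.length := by
  simp [wordPow]

theorem wordPow_cons_append_singleton (a : D) (t : List D) (m : ℕ) :
    wordPow (a :: t) m ++ [a] = a :: wordPow (t ++ [a]) m := by
  induction m with
  | zero => rfl
  | succ m ih => simp [wordPow_succ, ih]

theorem wordPow_rotate_one (l : List D) (m : ℕ) :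
    (wordPow l m).rotate 1 = wordPow (l.rotate 1) m := by
  cases l with
  | nil => simp
  | cons a t =>
    cases m with
    | zero => simp
    | succ m =>
      have := wordPow_cons_append_singleton a t m
      simp [wordPow_succ, this]

theorem wordPow_rotate (l : List D) (m k : ℕ) :
    (wordPow l m).rotate k = wordPow (l.rotate k) m := by
  induction k with
  | zero => simp
  | succ k ih => rw [← List.rotate_rotate, ih, wordPow_rotate_one, List.rotate_rotate]

theorem wordPow_injective {l l' : List D} {m : ℕ} (hm : m ≠ 0) (hl : l.length = l'.length)
    (h : wordPow l m = wordPow l' m) : l = l' := by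
  obtain ⟨m, rfl⟩ := Nat.exists_eq_succ_of_ne_zero hm
  rw [wordPow_succ, wordPow_succ] at h
  exact (List.append_inj h hl).1

/-- Commutation makes `p` a prefix of `t`; once it is cancelled, the remainder still commutes with
`p`. -/
theorem eq_wordPow_of_append_comm (p t : List D) (m : ℕ) (h : p ++ t = t ++ p)
    (hlen : t.length = m * p.length) : t = wordPow p m := by
  induction m generalizing t with
  | zero => simpa using hlen
  | succ m ih =>
    have hle : p.length ≤ t.length := by rw [hlen]; exact Nat.le_mul_of_pos_left _ (by omega)
    have hp : p <+: t := by
      apply List.prefix_of_prefix_length_le (l₃ := t ++ p) _ (List.prefix_append _ _) hle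
      exact ⟨t, h⟩
    obtain ⟨t', rfl⟩ := hp
    rw [wordPow_succ, ← ih t']
    · rw [List.append_assoc] at h
      exact List.append_cancel_left h
    · rw [List.length_append] at hlen
      linarith

/-- The period of a word under rotation. -/
noncomputable def rotationPeriod (l : List D) : ℕ :=
  Function.minimalPeriod (fun l : List D => l.rotate 1) l

theorem rotate_one_iterate (l : List D) (k : ℕ) :
    (fun l : List D => l.rotate 1)^[k] l = l.rotate k := by
  induction k with
  | zero => simp
  | succ k ih => rw [Function.iterate_succ_apply', ih, List.rotate_rotate]

theorem rotate_eq_self_iff_dvd (l : List D) (k : ℕ) :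
    l.rotate k = l ↔ rotationPeriod l ∣ k := by
  rw [rotationPeriod, ← Function.isPeriodicPt_iff_minimalPeriod_dvd, Function.IsPeriodicPt,
    Function.IsFixedPt, rotate_one_iterate]

theorem rotationPeriod_dvd_length (l : List D) : rotationPeriod l ∣ l.length :=
  (rotate_eq_self_iff_dvd l _).1 (List.rotate_length l)

theorem rotationPeriod_wordPow (l : List D) {m : ℕ} (hm : m ≠ 0) :
    rotationPeriod (wordPow l m) = rotationPeriod l := by
  refine Function.minimalPeriod_eq_minimalPeriod_iff.2 fun k => ?_
  rw [Function.IsPeriodicPt, Function.IsFixedPt, rotate_one_iterate, Function.IsPeriodicPt,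
    Function.IsFixedPt, rotate_one_iterate, wordPow_rotate]
  exact ⟨wordPow_injective hm (by simp), fun h => by rw [h]⟩

theorem rotationPeriod_rotate (l : List D) (k : ℕ) :
    rotationPeriod (l.rotate k) = rotationPeriod l := by
  refine Function.minimalPeriod_eq_minimalPeriod_iff.2 fun j => ?_
  rw [Function.IsPeriodicPt, Function.IsFixedPt, rotate_one_iterate, Function.IsPeriodicPt,
    Function.IsFixedPt, rotate_one_iterate, List.rotate_rotate, Nat.add_comm,
    ← List.rotate_rotate]
  exact ⟨fun h => List.rotate_injective k h, fun h => by rw [h]⟩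

/-- A nonempty word all of whose rotations are distinct. -/
def IsAperiodic (l : List D) : Prop := l ≠ [] ∧ rotationPeriod l = l.length

theorem IsAperiodic.rotate {l : List D} (h : IsAperiodic l) (k : ℕ) : IsAperiodic (l.rotate k) :=
  ⟨by simpa using h.1, by rw [rotationPeriod_rotate, h.2, List.length_rotate]⟩

theorem IsAperiodic.rotate_injective {l : List D} (h : IsAperiodic l) {i j : ℕ}
    (hi : i < l.length) (hj : j < l.length) (hij : l.rotate i = l.rotate j) : i = j := by
  rw [← rotate_one_iterate, ← rotate_one_iterate] at hij
  rw [← h.2] at hi hj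
  exact (Function.iterate_eq_iterate_iff_of_lt_minimalPeriod hi hj).1 hij

/-- The aperiodic root of a word. -/
theorem exists_wordPow_eq (l : List D) (hl : l ≠ []) :
    ∃ p m, IsAperiodic p ∧ wordPow p (m + 1) = l := by
  obtain ⟨c, hc⟩ := rotationPeriod_dvd_length l
  have hpos : 0 < l.length := List.length_pos_iff.2 hl
  have hc0 : c ≠ 0 := by rintro rfl; omega
  obtain ⟨m, rfl⟩ := Nat.exists_eq_succ_of_ne_zero hc0
  have hd0 : 0 < rotationPeriod l := by
    rcases Nat.eq_zero_or_pos (rotationPeriod l) with h | h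
    · rw [h] at hc; omega
    · exact h
  have hdle : rotationPeriod l ≤ l.length := Nat.le_of_dvd hpos (rotationPeriod_dvd_length l)
  have hplen : (l.take (rotationPeriod l)).length = rotationPeriod l := by simp [hdle]
  have hrot : l.rotate (rotationPeriod l) = l := (rotate_eq_self_iff_dvd l _).2 dvd_rfl
  rw [List.rotate_eq_drop_append_take hdle] at hrot
  -- Rotation by the period fixes `l`, so the initial block of that length commutes with the rest
  -- and `l` is a power of it.
  have hcomm : l.take (rotationPeriod l) ++ l.drop (rotationPeriod l) =
      l.drop (rotationPeriod l) ++ l.take (rotationPeriod l) := by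
    rw [hrot, List.take_append_drop]
  have hpow : wordPow (l.take (rotationPeriod l)) (m + 1) = l := by
    rw [wordPow_succ, ← eq_wordPow_of_append_comm _ _ m hcomm, List.take_append_drop]
    rw [hplen, List.length_drop, hc, Nat.succ_eq_add_one, mul_add, mul_one, Nat.add_sub_cancel,
      mul_comm]
  refine ⟨_, m, ⟨?_, ?_⟩, hpow⟩
  · intro h
    rw [h] at hplen
    simp only [List.length_nil] at hplen
    omega
  · conv_lhs => rw [← rotationPeriod_wordPow _ (Nat.succ_ne_zero m), hpow]
    exact hplen.symm

/-- Every nonempty word is a positive power of a unique aperiodic word. -/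
noncomputable def aperiodicPowEquiv :
    {p : List D // IsAperiodic p} × ℕ ≃ {l : List D // l ≠ []} :=
  Equiv.ofBijective
    (fun x => ⟨wordPow x.1.1 (x.2 + 1), by rw [wordPow_succ]; simp [x.1.2.1]⟩) (by
      constructor
      · rintro ⟨⟨p, hp⟩, m⟩ ⟨⟨p', hp'⟩, m'⟩ h
        have h' : wordPow p (m + 1) = wordPow p' (m' + 1) := congrArg Subtype.val h
        have hlen : p.length = p'.length := by
          rw [← hp.2, ← hp'.2, ← rotationPeriod_wordPow p (Nat.succ_ne_zero m), h',
            rotationPeriod_wordPow p' (Nat.succ_ne_zero m')]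
        have hmm : m = m' := by
          have h2 := congrArg List.length h'
          rw [length_wordPow, length_wordPow, hlen] at h2
          have : 0 < p'.length := List.length_pos_iff.2 hp'.1
          have := Nat.eq_of_mul_eq_mul_right this h2
          omega
        subst hmm
        obtain rfl := wordPow_injective (Nat.succ_ne_zero m) hlen h'
        rfl
      · rintro ⟨l, hl⟩
        obtain ⟨p, m, hp, h⟩ := exists_wordPow_eq l hl
        exact ⟨⟨⟨p, hp⟩, m⟩, Subtype.ext h⟩)

theorem aperiodicPowEquiv_apply (x : {p : List D // IsAperiodic p} × ℕ) :
    (aperiodicPowEquiv x).1 = wordPow x.1.1 (x.2 + 1) := rfl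

end CyclicWords

/-! ### Weights of cyclic words as matrix traces -/

section CyclicWeight

variable {D : Type*} {R : Type*} [CommSemiring R] (W : D → D → R)

/-- The weight `W e₁ e₂ * W e₂ e₃ * ⋯ * W eₗ e₁` of a cyclic word. -/
def cyclicWeight (l : List D) : R := (List.zipWith W l (l.rotate 1)).prod

theorem cyclicWeight_wordPow (l : List D) (m : ℕ) :
    cyclicWeight W (wordPow l m) = cyclicWeight W l ^ m := by
  rw [cyclicWeight, wordPow_rotate_one]
  induction m with
  | zero => simp
  | succ m ih =>
    rw [wordPow_succ, wordPow_succ, List.zipWith_append (by simp), List.prod_append, ih, pow_succ',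
      cyclicWeight]

theorem cyclicWeight_cons (a : D) (t : List D) :
    cyclicWeight W (a :: t) = (List.zipWith W (a :: t) (t ++ [a])).prod := by
  simp [cyclicWeight]

/-- Paths from `a` to `b` with `n` intermediate letters have `n + 1` steps; closing up with `b = a`
gives the trace. -/
theorem sum_path_weight [Fintype D] [DecidableEq D] (a b : D) (n : ℕ) :
    ∑ v : List.Vector D n, (List.zipWith W (a :: v.1) (v.1 ++ [b])).prod =
      (Matrix.of W ^ (n + 1)) a b := by
  induction n generalizing a with
  | zero =>
    rw [Fintype.sum_eq_single List.Vector.nil fun v hv => absurd (Subsingleton.elim _ _) hv]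
    simp [List.Vector.nil]
  | succ n ih =>
    let e : D × List.Vector D n ≃ List.Vector D (n + 1) :=
      ⟨fun x => x.1 ::ᵥ x.2, fun v => (v.head, v.tail), fun x => by simp, fun v => by simp⟩
    rw [← e.sum_comp, Fintype.sum_prod_type, pow_succ' (Matrix.of W) (n + 1), Matrix.mul_apply]
    refine Finset.sum_congr rfl fun c _ => ?_
    rw [← ih c, Finset.mul_sum]
    refine Finset.sum_congr rfl fun v _ => ?_
    have hv : (e (c, v)).1 = c :: v.1 := rfl
    rw [hv]
    simp

theorem sum_cyclicWeight [Fintype D] [DecidableEq D] (n : ℕ) :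
    ∑ v : List.Vector D (n + 1), cyclicWeight W v.1 = (Matrix.of W ^ (n + 1)).trace := by
  let e : D × List.Vector D n ≃ List.Vector D (n + 1) :=
    ⟨fun x => x.1 ::ᵥ x.2, fun v => (v.head, v.tail), fun x => by simp, fun v => by simp⟩
  rw [← e.sum_comp, Fintype.sum_prod_type, Matrix.trace]
  refine Finset.sum_congr rfl fun c _ => ?_
  rw [Matrix.diag_apply, ← sum_path_weight]
  refine Finset.sum_congr rfl fun v _ => ?_
  have hv : (e (c, v)).1 = c :: v.1 := rfl
  rw [hv, cyclicWeight_cons]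

end CyclicWeight

/-! ### Absolute convergence and the logarithmic Euler product -/

section WeightSeries

variable {D : Type*}

theorem norm_cyclicWeight_le (W : D → D → ℂ) {M : ℝ} (hM : ∀ i j, ‖W i j‖ ≤ M) (l : List D) :
    ‖cyclicWeight W l‖ ≤ M ^ l.length := by
  have key : ∀ l l' : List D, l.length = l'.length →
      ‖(List.zipWith W l l').prod‖ ≤ M ^ l.length := by
    intro l
    induction l with
    | nil => intro l' _; simp
    | cons a t ih =>
      intro l' h
      cases l' with
      | nil => simp at h
      | cons b t' =>
        have h0 : 0 ≤ M := (norm_nonneg _).trans (hM a b)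
        rw [List.zipWith_cons_cons, List.prod_cons, norm_mul, List.length_cons, pow_succ']
        exact mul_le_mul (hM a b) (ih t' (by simpa using h)) (norm_nonneg _) h0
  exact key l _ (by simp)

variable [Fintype D]

theorem summable_list_pow_length {r : ℝ} (hr : 0 ≤ r) (h : r * Fintype.card D < 1) :
    Summable fun l : List D => r ^ l.length := by
  rw [← (Equiv.sigmaFiberEquiv (List.length (α := D))).summable_iff]
  have hfin : ∀ n, Finite {l : List D // l.length = n} := fun n =>
    inferInstanceAs (Finite (List.Vector D n))
  refine (summable_sigma_of_nonneg fun _ => pow_nonneg hr _).2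
    ⟨fun n => Summable.of_finite, ?_⟩
  have : ∀ n, ∑' x : {l : List D // l.length = n},
      ((fun l : List D => r ^ l.length) ∘ Equiv.sigmaFiberEquiv List.length) ⟨n, x⟩ =
        (r * Fintype.card D) ^ n := by
    intro n
    have h1 : ∀ x : {l : List D // l.length = n},
      ((fun l : List D => r ^ l.length) ∘ Equiv.sigmaFiberEquiv List.length) ⟨n, x⟩ = r ^ n := by
      intro x
      have := x.2
      simp [Equiv.sigmaFiberEquiv, this]
    simp_rw [h1]
    rw [tsum_const, show Nat.card {l : List D // l.length = n} = Fintype.card D ^ n by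
      rw [← card_vector n, ← Nat.card_eq_fintype_card]; rfl]
    simp [mul_pow, mul_comm]
  exact (summable_congr this).2 (summable_geometric_of_lt_one (by positivity) h)

variable [DecidableEq D]

/-- Absolute convergence allows regrouping the words by length, and each positive length contributes
a trace. The empty word and the index k = 0 both contribute zero through division by zero. -/
theorem hasSum_list_of_hasSum_trace (W : D → D → ℂ) {M : ℝ} (hM : ∀ i j, ‖W i j‖ ≤ M)
    (hM0 : 0 ≤ M) {q a : ℂ} (hq : ‖q‖ * M * Fintype.card D < 1)
    (ha : HasSum (fun k : ℕ => q ^ k * (Matrix.of W ^ k).trace / k) a) :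
    HasSum (fun l : List D => q ^ l.length * cyclicWeight W l / l.length) a := by
  have hs : Summable fun l : List D => q ^ l.length * cyclicWeight W l / l.length := by
    refine Summable.of_norm_bounded (summable_list_pow_length (by positivity) hq) fun l => ?_
    rw [norm_div, norm_mul, norm_pow, mul_pow]
    rcases Nat.eq_zero_or_pos l.length with h0 | h0
    · simp [h0]
    · have h1 : (1 : ℝ) ≤ ‖(l.length : ℂ)‖ := by
        rw [Complex.norm_natCast]; exact_mod_cast h0
      refine (div_le_self (by positivity) h1).trans ?_
      gcongr
      exact norm_cyclicWeight_le W hM l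
  have hfib := ((Equiv.sigmaFiberEquiv (List.length (α := D))).summable_iff.2 hs).hasSum
  have hfin : ∀ n, Fintype {l : List D // l.length = n} := fun n =>
    inferInstanceAs (Fintype (List.Vector D n))
  have h2 := hfib.sigma (g := fun k : ℕ => q ^ k * (Matrix.of W ^ k).trace / k) fun n => by
    convert hasSum_fintype _ using 1
    have h1 : ∀ x : {l : List D // l.length = n},
        ((fun l : List D => q ^ l.length * cyclicWeight W l / l.length) ∘
          Equiv.sigmaFiberEquiv List.length) ⟨n, x⟩ = q ^ n * cyclicWeight W x.1 / n := by
      intro x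
      have := x.2
      simp [Equiv.sigmaFiberEquiv, this]
    simp_rw [h1]
    cases n with
    | zero => simp
    | succ n =>
      rw [← sum_cyclicWeight, Finset.mul_sum, Finset.sum_div]
      exact Fintype.sum_congr _ _ (fun _ => rfl) |>.trans (by congr)
  rw [ha.unique h2]
  exact (Equiv.sigmaFiberEquiv (List.length (α := D))).hasSum_iff.1 hfib

/-- The logarithmic Euler product over aperiodic words. -/
theorem hasSum_aperiodic_of_hasSum_trace (W : D → D → ℂ) {M : ℝ} (hM : ∀ i j, ‖W i j‖ ≤ M)
    (hM1 : 1 ≤ M) {q a : ℂ} (hq : ‖q‖ * M * Fintype.card D < 1) (hq' : ‖q‖ * M < 1)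
    (ha : HasSum (fun k : ℕ => q ^ k * (Matrix.of W ^ k).trace / k) a) :
    HasSum (fun p : {p : List D // IsAperiodic p} =>
      -Complex.log (1 - q ^ p.1.length * cyclicWeight W p.1) / p.1.length) a := by
  have h1 := hasSum_list_of_hasSum_trace W hM (by linarith) hq ha
  have h2 : HasSum (fun l : {l : List D // l ≠ []} =>
      q ^ l.1.length * cyclicWeight W l.1 / l.1.length) a := by
    refine (hasSum_subtype_iff_of_support_subset (s := {l : List D | l ≠ []}) ?_).2 h1
    rintro l hl rfl
    simp at hl
  rw [← aperiodicPowEquiv.hasSum_iff] at h2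
  -- For fixed `p` with x = q^|p| · weight(p), the powers of `p` contribute x^(m+1) / ((m+1)|p|),
  -- the logarithm series divided by |p|.
  refine h2.prod_fiberwise fun p => ?_
  have hlt : ‖q ^ p.1.length * cyclicWeight W p.1‖ < 1 := by
    have hpos : p.1.length ≠ 0 := (List.length_pos_iff.2 p.2.1).ne'
    calc ‖q ^ p.1.length * cyclicWeight W p.1‖ ≤ ‖q‖ ^ p.1.length * M ^ p.1.length := by
          rw [norm_mul, norm_pow]
          gcongr
          exact norm_cyclicWeight_le W hM _
      _ = (‖q‖ * M) ^ p.1.length := (mul_pow _ _ _).symm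
      _ < 1 := pow_lt_one₀ (by positivity) hq' hpos
  convert! (Complex.hasSum_taylorSeries_neg_log' hlt).div_const (p.1.length : ℂ) using 2 with m
  simp only [Function.comp, aperiodicPowEquiv_apply, length_wordPow, cyclicWeight_wordPow]
  push_cast
  rw [mul_pow, ← pow_mul, mul_comm p.1.length, div_div]

end WeightSeries

/-! ### From aperiodic words to primitive cycles -/

section EulerProduct

variable {V : Type*} {G : SimpleGraph V}

theorem isCycleClass_coe {l : List G.Dart} :
    IsCycleClass G (l : Cycle G.Dart) ↔ l ≠ [] ∧ (l : Cycle G.Dart).Chain G.DartAdj := by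
  rw [IsCycleClass, Ne, Cycle.coe_eq_nil]

variable [DecidableEq V]

/-- The Bartholdi edge weight of a pair of directed edges: `1` if the second continues the first
without a bump, `u` if it is a bump, and `0` otherwise. -/
def dartWeight (u : ℂ) (e f : G.Dart) : ℂ :=
  if e.snd = f.fst then (if f = e.symm then u else 1) else 0

theorem prod_dartWeight_of_isChain (u : ℂ) (a b : G.Dart) (t : List G.Dart)
    (h : List.IsChain G.DartAdj (a :: (t ++ [b]))) :
    (List.zipWith (dartWeight u) (a :: t) (t ++ [b])).prod =
      u ^ (List.zipWith (fun e f : G.Dart => decide (f = e.symm)) (a :: t) (t ++ [b])).count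
        true := by
  induction t generalizing a with
  | nil =>
    have h1 : a.snd = b.fst := by simpa [SimpleGraph.DartAdj] using h
    by_cases hb : b = a.symm
    · subst hb
      simp [dartWeight]
    · simp [dartWeight, h1, hb]
  | cons c t ih =>
    rw [List.cons_append, List.isChain_cons_cons] at h
    have h1 : a.snd = c.fst := h.1
    have ih' := ih c h.2
    rw [List.cons_append, List.zipWith_cons_cons, List.prod_cons, ih', List.zipWith_cons_cons,
      List.count_cons]
    by_cases hb : c = a.symm
    · subst hb
      simp [dartWeight, pow_succ']
    · simp [dartWeight, h1, hb]

theorem prod_dartWeight_of_not_isChain (u : ℂ) (a b : G.Dart) (t : List G.Dart)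
    (h : ¬ List.IsChain G.DartAdj (a :: (t ++ [b]))) :
    (List.zipWith (dartWeight u) (a :: t) (t ++ [b])).prod = 0 := by
  induction t generalizing a with
  | nil =>
    have h1 : ¬ a.snd = b.fst := by simpa [SimpleGraph.DartAdj] using h
    simp [dartWeight, h1]
  | cons c t ih =>
    rw [List.cons_append, List.isChain_cons_cons, not_and_or] at h
    rw [List.cons_append, List.zipWith_cons_cons, List.prod_cons]
    rcases h with h | h
    · have h1 : ¬ a.snd = c.fst := h
      simp [dartWeight, h1]
    · rw [ih c h, mul_zero]

theorem cyclicWeight_dartWeight_of_chain (u : ℂ) {l : List G.Dart} (hl : l ≠ [])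
    (h : (l : Cycle G.Dart).Chain G.DartAdj) :
    cyclicWeight (dartWeight u) l = u ^ listBumps l := by
  obtain ⟨a, t, rfl⟩ := List.exists_cons_of_ne_nil hl
  rw [Cycle.chain_coe_cons] at h
  rw [cyclicWeight_cons, prod_dartWeight_of_isChain u a a t h]
  simp [listBumps]

theorem cyclicWeight_dartWeight_of_not_chain (u : ℂ) {l : List G.Dart} (hl : l ≠ [])
    (h : ¬ (l : Cycle G.Dart).Chain G.DartAdj) :
    cyclicWeight (dartWeight u) l = 0 := by
  obtain ⟨a, t, rfl⟩ := List.exists_cons_of_ne_nil hl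
  rw [Cycle.chain_coe_cons] at h
  rw [cyclicWeight_cons, prod_dartWeight_of_not_isChain u a a t h]

/-- At u = 1 the cyclic weight is the indicator of being a closed chain, and it is multiplicative
under powers. -/
theorem chain_of_chain_wordPow {p : List G.Dart} (hp : p ≠ []) {m : ℕ} (hm : m ≠ 0)
    (h : (wordPow p m : Cycle G.Dart).Chain G.DartAdj) :
    (p : Cycle G.Dart).Chain G.DartAdj := by
  by_contra hc
  have h0 : wordPow p m ≠ [] := by
    obtain ⟨k, rfl⟩ := Nat.exists_eq_succ_of_ne_zero hm
    rw [wordPow_succ]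
    simp [hp]
  have h1 := cyclicWeight_dartWeight_of_chain 1 h0 h
  rw [cyclicWeight_wordPow, cyclicWeight_dartWeight_of_not_chain 1 hp hc, zero_pow hm] at h1
  simp at h1

/-- A primitive word equals its aperiodic root, since that root is itself a cycle. Conversely, an
r-th power of `p` has period at most |p|, which is less than its length when r ≥ 2. -/
theorem isPrimitive_coe_iff {l : List G.Dart} (hl : IsCycleClass G (l : Cycle G.Dart)) :
    IsPrimitive G (l : Cycle G.Dart) ↔ IsAperiodic l := by
  have hl' := isCycleClass_coe.1 hl
  constructor
  · intro h
    obtain ⟨p, m, hp, hpow⟩ := exists_wordPow_eq l hl'.1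
    rcases Nat.eq_zero_or_pos m with rfl | hm
    · have : p = l := by simpa [wordPow_succ] using hpow
      exact this ▸ hp
    · refine absurd ?_ (h p (m + 1) ?_ (by omega))
      · exact congrArg _ hpow.symm
      · exact isCycleClass_coe.2 ⟨hp.1, chain_of_chain_wordPow hp.1 (Nat.succ_ne_zero m)
          (hpow ▸ hl'.2)⟩
  · rintro h p r hp hr heq
    obtain ⟨k, hk⟩ := Cycle.coe_eq_coe.1 heq
    have h1 := congrArg rotationPeriod hk
    rw [rotationPeriod_rotate] at h1
    have h2 := h.2
    have hlen : l.length = r * p.length := by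
      rw [← List.length_rotate l k, hk]
      exact length_wordPow p r
    have h3 : rotationPeriod (wordPow p r) = rotationPeriod p :=
      rotationPeriod_wordPow p (by omega)
    have h4 : rotationPeriod p ≤ p.length :=
      Nat.le_of_dvd (List.length_pos_iff.2 (isCycleClass_coe.1 hp).1)
        (rotationPeriod_dvd_length p)
    have h5 : l.length ≤ p.length := by
      rw [← h2, h1]
      exact h3.trans_le h4
    have h6 : 0 < p.length := List.length_pos_iff.2 (isCycleClass_coe.1 hp).1
    nlinarith

/-- The words representing primitive cycles. -/
def PrimitiveWord (G : SimpleGraph V) : Type _ :=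
  {p : List G.Dart // IsAperiodic p ∧ (p : Cycle G.Dart).Chain G.DartAdj}

/-- The primitive cycle represented by a word. -/
def PrimitiveWord.toCycle (p : PrimitiveWord G) : PrimitiveCycle G :=
  ⟨(p.1 : Cycle G.Dart), isCycleClass_coe.2 ⟨p.2.1.1, p.2.2⟩,
    (isPrimitive_coe_iff (isCycleClass_coe.2 ⟨p.2.1.1, p.2.2⟩)).2 p.2.1⟩

/-- The representatives are the rotations of one aperiodic word, all distinct. Their number cancels
the factor 1/|p| of the logarithmic Euler product. -/
theorem card_fiber_toCycle (C : PrimitiveCycle G) :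
    Finite {p : PrimitiveWord G // p.toCycle = C} ∧
      Nat.card {p : PrimitiveWord G // p.toCycle = C} = C.1.length := by
  obtain ⟨c, hc, hp⟩ := C
  induction c using Quotient.inductionOn' with
  | h l =>
  have hl : IsAperiodic l := (isPrimitive_coe_iff hc).1 hp
  have hrot : ∀ k, ((l.rotate k : List G.Dart) : Cycle G.Dart) = (l : Cycle G.Dart) := fun k =>
    Cycle.coe_eq_coe.2 (List.IsRotated.symm ⟨k, rfl⟩)
  let f : Fin l.length → {p : PrimitiveWord G // p.toCycle = ⟨(l : Cycle G.Dart), hc, hp⟩} :=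
    fun k => ⟨⟨l.rotate k, hl.rotate k, by rw [hrot]; exact hc.2⟩, Subtype.ext (hrot k)⟩
  have hf : Function.Bijective f := by
    constructor
    · intro i j hij
      have : l.rotate i = l.rotate j := congrArg (fun x => x.1.1) hij
      exact Fin.ext (hl.rotate_injective i.2 j.2 this)
    · rintro ⟨⟨p, hp1, hp2⟩, h⟩
      have h' : (p : Cycle G.Dart) = (l : Cycle G.Dart) := congrArg Subtype.val h
      obtain ⟨k, hk⟩ := (Cycle.coe_eq_coe.1 h').symm
      refine ⟨⟨k % l.length, Nat.mod_lt _ (List.length_pos_iff.2 hl.1)⟩, ?_⟩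
      apply Subtype.ext
      apply Subtype.ext
      change l.rotate (k % l.length) = p
      rw [List.rotate_mod, hk]
  let e := Equiv.ofBijective f hf
  refine ⟨Finite.of_equiv _ e, ?_⟩
  have := Nat.card_congr e
  rw [Nat.card_eq_fintype_card, Fintype.card_fin] at this
  exact this.symm

variable [Fintype V] [DecidableRel G.Adj]

/-- The Euler product of the Bartholdi zeta function is `1 / det (1 - q W)` near `q = 0`. -/
theorem eventually_hasProd_inv_det (u : ℂ) :
    ∀ᶠ q in 𝓝 (0 : ℂ),
      HasProd (fun C : PrimitiveCycle G => 1 / (1 - q ^ C.1.length * u ^ bumps C.1))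
        (det (1 - q • Matrix.of (dartWeight (G := G) u)))⁻¹ := by
  set M : ℝ := max 1 ‖u‖ with hMdef
  have hM1 : 1 ≤ M := le_max_left _ _
  have hM : ∀ e f : G.Dart, ‖dartWeight u e f‖ ≤ M := by
    intro e f
    unfold dartWeight
    split_ifs
    · exact le_max_right _ _
    · simpa using hM1
    · simp only [norm_zero]; linarith
  have hcont : ∀ c : ℝ, ∀ᶠ q in 𝓝 (0 : ℂ), ‖q‖ * c < 1 := by
    intro c
    have : Tendsto (fun q : ℂ => ‖q‖ * c) (𝓝 0) (𝓝 (‖(0 : ℂ)‖ * c)) := by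
      apply Continuous.tendsto
      fun_prop
    exact this.eventually_lt_const (by simp)
  filter_upwards [eventually_hasSum_trace_pow (Matrix.of (dartWeight (G := G) u)),
    hcont (M * Fintype.card G.Dart), hcont M] with q hq h1 h2
  obtain ⟨a, ha, ha'⟩ := hq
  rw [← ha']
  have hs := hasSum_aperiodic_of_hasSum_trace (dartWeight (G := G) u) hM hM1
    (by rwa [mul_assoc]) h2 ha
  let g : PrimitiveCycle G → ℂ := fun C => -Complex.log (1 - q ^ C.1.length * u ^ bumps C.1)
  let i : PrimitiveWord G → {p : List G.Dart // IsAperiodic p} := fun p => ⟨p.1, p.2.1⟩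
  have hi : Function.Injective i := fun p p' h => Subtype.ext (congrArg (fun x => x.1) h)
  -- Aperiodic words that are not closed chains have weight 0 and contribute log 1 = 0, so they can
  -- be dropped.
  have hs2 : HasSum (fun p : PrimitiveWord G => g p.toCycle / p.toCycle.1.length) a := by
    have := (hi.hasSum_iff ?_).2 hs
    · convert! this using 2 with p
      change _ = -Complex.log (1 - q ^ p.1.length * cyclicWeight (dartWeight u) p.1) / p.1.length
      rw [cyclicWeight_dartWeight_of_chain u p.2.1.1 p.2.2]
      rfl
    · rintro ⟨p, hp⟩ hpi
      have hch : ¬ (p : Cycle G.Dart).Chain G.DartAdj := fun hch => hpi ⟨⟨p, hp, hch⟩, rfl⟩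
      simp only [cyclicWeight_dartWeight_of_not_chain u hp.1 hch]
      simp
  have hs3 : HasSum g a := by
    refine ((Equiv.sigmaFiberEquiv (PrimitiveWord.toCycle (G := G))).hasSum_iff.2 hs2).sigma
      fun C => ?_
    obtain ⟨hfin, hcard⟩ := card_fiber_toCycle C
    have := Fintype.ofFinite {p : PrimitiveWord G // p.toCycle = C}
    convert hasSum_fintype _ using 1
    have hterm : ∀ p : {p : PrimitiveWord G // p.toCycle = C},
        ((fun p : PrimitiveWord G => g p.toCycle / p.toCycle.1.length) ∘
          Equiv.sigmaFiberEquiv PrimitiveWord.toCycle) ⟨C, p⟩ = g C / C.1.length := by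
      rintro ⟨p, rfl⟩
      rfl
    simp_rw [hterm]
    have hpos : (C.1.length : ℂ) ≠ 0 := by
      obtain ⟨⟨c, hc, hp⟩, rfl⟩ : ∃ C', C' = C := ⟨C, rfl⟩
      induction c using Quotient.inductionOn' with
      | h l =>
      have hl : IsAperiodic l := (isPrimitive_coe_iff hc).1 hp
      exact Nat.cast_ne_zero.2 (List.length_pos_iff.2 hl.1).ne'
    rw [Finset.sum_const, Finset.card_univ, ← Nat.card_eq_fintype_card, hcard, nsmul_eq_mul,
      mul_div_cancel₀ _ hpos]
  convert! hs3.cexp using 1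
  funext C
  -- Each factor is nonzero because its cycle term has norm below 1; hence `exp` undoes the
  -- logarithm.
  have hne : 1 - q ^ C.1.length * u ^ bumps C.1 ≠ 0 := by
    obtain ⟨⟨c, hc, hp⟩, rfl⟩ : ∃ C', C' = C := ⟨C, rfl⟩
    induction c using Quotient.inductionOn' with
    | h l =>
    have hl := isCycleClass_coe.1 hc
    change 1 - q ^ l.length * u ^ listBumps l ≠ 0
    rw [← cyclicWeight_dartWeight_of_chain u hl.1 hl.2]
    intro h0
    have hlt : ‖q ^ l.length * cyclicWeight (dartWeight u) l‖ < 1 := by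
      calc ‖q ^ l.length * cyclicWeight (dartWeight u) l‖ ≤ ‖q‖ ^ l.length * M ^ l.length := by
            rw [norm_mul, norm_pow]
            gcongr
            exact norm_cyclicWeight_le _ hM _
        _ = (‖q‖ * M) ^ l.length := (mul_pow _ _ _).symm
        _ < 1 := pow_lt_one₀ (by positivity) h2 (List.length_pos_iff.2 hl.1).ne'
    rw [← sub_eq_zero.1 h0] at hlt
    simp at hlt
  rw [Function.comp, Complex.exp_neg, Complex.exp_log hne, one_div]

end EulerProduct

/-! ### Darts as edges with two directions -/

section DartSums

variable {V : Type*} {G : SimpleGraph V}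

theorem EdgeDirection.dart_ne_symm (o : EdgeDirection G) (e f : G.edgeSet) :
    o.dart e ≠ (o.dart f).symm := by
  intro h
  have h1 : (o.dart e).edge = (o.dart f).edge := by rw [h, SimpleGraph.Dart.edge_symm]
  rw [o.edge_dart, o.edge_dart] at h1
  obtain rfl := Subtype.ext h1
  exact (o.dart e).symm_ne h.symm

theorem EdgeDirection.dart_injective (o : EdgeDirection G) : Function.Injective o.dart := by
  intro e f h
  have := congrArg SimpleGraph.Dart.edge h
  rw [o.edge_dart, o.edge_dart] at this
  exact Subtype.ext this

/-- Directed edges are edges with one of two directions. -/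
noncomputable def EdgeDirection.dartEquiv (o : EdgeDirection G) :
    G.edgeSet ⊕ G.edgeSet ≃ G.Dart :=
  Equiv.ofBijective (Sum.elim o.dart fun e => (o.dart e).symm) (by
    constructor
    · rintro (e | e) (f | f) h
      · exact congrArg _ (o.dart_injective h)
      · exact absurd h (o.dart_ne_symm e f)
      · exact absurd h.symm (o.dart_ne_symm f e)
      · exact congrArg _ (o.dart_injective (SimpleGraph.Dart.symm_involutive.injective h))
    · intro d
      have h : (o.dart ⟨d.edge, d.edge_mem⟩).edge = d.edge := o.edge_dart _
      rcases SimpleGraph.dart_edge_eq_iff _ _ |>.1 h with h | h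
      · exact ⟨Sum.inl ⟨d.edge, d.edge_mem⟩, h⟩
      · refine ⟨Sum.inr ⟨d.edge, d.edge_mem⟩, ?_⟩
        simp [h])

@[simp] theorem EdgeDirection.dartEquiv_inl (o : EdgeDirection G) (e : G.edgeSet) :
    o.dartEquiv (Sum.inl e) = o.dart e := rfl

@[simp] theorem EdgeDirection.dartEquiv_inr (o : EdgeDirection G) (e : G.edgeSet) :
    o.dartEquiv (Sum.inr e) = (o.dart e).symm := rfl

variable [Fintype V] [DecidableRel G.Adj]

theorem EdgeDirection.sum_dart {R : Type*} [AddCommMonoid R] (o : EdgeDirection G)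
    (f : G.Dart → R) : ∑ d, f d = ∑ e, (f (o.dart e) + f (o.dart e).symm) := by
  rw [← o.dartEquiv.sum_comp, Fintype.sum_sum_type, ← Finset.sum_add_distrib]
  rfl

variable [DecidableEq V]

theorem sum_dart_fst {R : Type*} [AddCommMonoid R] (v : V) (f : V → R) :
    ∑ d : G.Dart, (if d.fst = v then f d.snd else 0) = ∑ w ∈ G.neighborFinset v, f w := by
  rw [← Finset.sum_filter, G.dart_fst_fiber v,
    Finset.sum_image (fun x _ y _ h => G.dartOfNeighborSet_injective v h)]
  simp only [SimpleGraph.dartOfNeighborSet]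
  rw [SimpleGraph.neighborFinset, Finset.sum_subtype (G.neighborSet v).toFinset
    (fun x => Set.mem_toFinset)]

end DartSums

/-! ### The Bass–Bartholdi determinant formula -/

section Bass

variable {V : Type*} [Fintype V] [DecidableEq V] {G : SimpleGraph V}

/-- The matrix of the inversion of directed edges. -/
def dartInversion (G : SimpleGraph V) : Matrix G.Dart G.Dart ℂ :=
  Matrix.of fun e f => if f = e.symm then 1 else 0

/-- The matrix from directed edges to their targets. -/
def dartTarget (G : SimpleGraph V) : Matrix G.Dart V ℂ :=
  Matrix.of fun e v => if e.snd = v then 1 else 0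

/-- The matrix from vertices to the directed edges leaving them. -/
def dartSource (G : SimpleGraph V) : Matrix V G.Dart ℂ :=
  Matrix.of fun v e => if e.fst = v then 1 else 0

/-- The product target · source gives weight 1 to every composable pair, bumps included; subtracting
1 - u on bumps corrects their weight to u. -/
theorem of_dartWeight_eq (u : ℂ) : Matrix.of (dartWeight (G := G) u) =
    dartTarget G * dartSource G - (1 - u) • dartInversion G := by
  ext e f
  by_cases hf : f = e.symm
  · subst hf
    simp [dartWeight, dartTarget, dartSource, dartInversion, Matrix.mul_apply]
  · simp [dartWeight, dartTarget, dartSource, dartInversion, Matrix.mul_apply, hf, eq_comm]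

variable [DecidableRel G.Adj]

theorem dartInversion_mul_self : dartInversion G * dartInversion G = 1 := by
  ext e f
  simp only [dartInversion, Matrix.mul_apply, Matrix.of_apply, ite_mul, one_mul, zero_mul,
    Finset.sum_ite_eq', Finset.mem_univ, if_true, SimpleGraph.Dart.symm_symm, Matrix.one_apply,
    eq_comm]

theorem dartSource_mul_dartTarget : dartSource G * dartTarget G = G.adjMatrix ℂ := by
  ext v w
  have := sum_dart_fst (G := G) v (fun x => if x = w then (1 : ℂ) else 0)
  simp only [Finset.sum_ite_eq', SimpleGraph.mem_neighborFinset] at this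
  simp only [dartSource, dartTarget, Matrix.mul_apply, Matrix.of_apply, ite_mul, one_mul, zero_mul,
    this, SimpleGraph.adjMatrix_apply]

theorem dartSource_mul_dartInversion_mul_dartTarget :
    dartSource G * (dartInversion G * dartTarget G) = G.degMatrix ℂ := by
  ext v w
  have h1 : ∀ e : G.Dart, (dartInversion G * dartTarget G) e w = if e.fst = w then 1 else 0 := by
    intro e
    simp only [dartInversion, dartTarget, Matrix.mul_apply, Matrix.of_apply, ite_mul, one_mul,
      zero_mul, Finset.sum_ite_eq', Finset.mem_univ, if_true]
    rfl
  simp only [Matrix.mul_apply (M := dartSource G), h1]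
  by_cases hvw : v = w
  · subst hvw
    have := sum_dart_fst (G := G) v (fun _ => (1 : ℂ))
    simp only [dartSource, Matrix.of_apply, ite_mul, one_mul, zero_mul]
    rw [SimpleGraph.degMatrix, Matrix.diagonal_apply_eq]
    simp only [← ite_and, and_self]
    rw [this]
    simp
  · rw [SimpleGraph.degMatrix, Matrix.diagonal_apply_ne _ hvw]
    refine Finset.sum_eq_zero fun e _ => ?_
    simp only [dartSource, Matrix.of_apply, ite_mul, one_mul, zero_mul, ← ite_and]
    exact if_neg fun h => hvw (h.1.symm.trans h.2)

/-- Inversion swaps the two copies of the edge set, so the matrix has blocks 1, z, z, 1. -/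
theorem det_one_add_smul_dartInversion (o : EdgeDirection G) (z : ℂ) :
    det (1 + z • dartInversion G) = (1 - z ^ 2) ^ nE G := by
  rw [← det_submatrix_equiv_self o.dartEquiv]
  have h : (1 + z • dartInversion G).submatrix o.dartEquiv o.dartEquiv =
      fromBlocks 1 (z • 1) (z • 1) 1 := by
    ext (e | e) (f | f)
    · have := o.dart_ne_symm f e
      simp [dartInversion, Matrix.one_apply, this, o.dart_injective.eq_iff]
    · have := o.dart_ne_symm e f
      have h2 : (o.dart f).symm = (o.dart e).symm ↔ e = f := by
        rw [SimpleGraph.Dart.symm_involutive.injective.eq_iff, o.dart_injective.eq_iff, eq_comm]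
      simp [dartInversion, Matrix.one_apply, this, h2]
    · have := (o.dart_ne_symm f e).symm
      simp [dartInversion, Matrix.one_apply, this, o.dart_injective.eq_iff, eq_comm]
    · have := (o.dart_ne_symm e f).symm
      have h2 : (o.dart e).symm = (o.dart f).symm ↔ e = f := by
        rw [SimpleGraph.Dart.symm_involutive.injective.eq_iff, o.dart_injective.eq_iff]
      simp [dartInversion, Matrix.one_apply, this, h2]
  rw [h, det_fromBlocks_one₁₁]
  have h3 : (1 : Matrix G.edgeSet G.edgeSet ℂ) - (z • 1) * (z • 1) = (1 - z ^ 2) • 1 := by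
    rw [smul_mul_smul_comm, Matrix.one_mul, sub_smul, one_smul, sq]
  rw [h3, det_smul, det_one, mul_one, nE, SimpleGraph.edgeFinset_card]

/-- The vertex matrix `1 - q A + (1 - u) q ^ 2 (D - (1 - u))` of Bass' formula, with
`t = 1 - u`. -/
noncomputable def bassMatrix (G : SimpleGraph V) [DecidableRel G.Adj] (t q : ℂ) : Matrix V V ℂ :=
  1 - q • G.adjMatrix ℂ + (t * q ^ 2) • (G.degMatrix ℂ - t • 1)

/-- Bartholdi's generalization of Bass' determinant formula. -/
theorem det_one_sub_smul_dartWeight (o : EdgeDirection G) (u q : ℂ)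
    (hc : 1 - ((1 - u) * q) ^ 2 ≠ 0) :
    det (1 - q • Matrix.of (dartWeight (G := G) u)) =
      (1 - ((1 - u) * q) ^ 2) ^ ((nE G : ℤ) - nV G) * det (bassMatrix G (1 - u) q) := by
  set t := 1 - u with ht
  set c := 1 - (t * q) ^ 2 with hcdef
  -- As the inversion J satisfies J² = 1, the inverse of 1 + tqJ is c⁻¹(1 - tqJ). Factoring out 1 +
  -- tqJ leaves a perturbation of the identity that passes through the vertices.
  have h1 : 1 - q • Matrix.of (dartWeight (G := G) u) = (1 + (t * q) • dartInversion G) *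
      (1 - ((q * c⁻¹) • ((1 - (t * q) • dartInversion G) * dartTarget G)) * dartSource G) := by
    have h2 : (1 + (t * q) • dartInversion G) * (1 - (t * q) • dartInversion G) =
        c • (1 : Matrix G.Dart G.Dart ℂ) := by
      simp only [Matrix.mul_sub, Matrix.add_mul, Matrix.mul_one, Matrix.one_mul, Matrix.smul_mul,
        Matrix.mul_smul, dartInversion_mul_self, hcdef]
      module
    rw [Matrix.mul_sub, Matrix.mul_one, Matrix.smul_mul, Matrix.mul_smul, ← Matrix.mul_assoc,
      ← Matrix.mul_assoc, h2, Matrix.smul_mul, Matrix.smul_mul, Matrix.one_mul, smul_smul,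
      inv_mul_cancel_right₀ hc, of_dartWeight_eq, smul_sub, smul_smul, mul_comm q]
    abel
  have h3 : bassMatrix G t q = c • (1 - dartSource G *
      ((q * c⁻¹) • ((1 - (t * q) • dartInversion G) * dartTarget G))) := by
    rw [Matrix.sub_mul, Matrix.one_mul, Matrix.smul_mul, Matrix.mul_smul, Matrix.mul_sub,
      Matrix.mul_smul, dartSource_mul_dartTarget, dartSource_mul_dartInversion_mul_dartTarget,
      smul_sub, smul_smul, mul_comm c, inv_mul_cancel_right₀ hc, bassMatrix, hcdef]
    module
  -- The identity det(1 - XY) = det(1 - YX) moves from darts to vertices. The power c^n_E comes from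
  -- 1 + tqJ, and clearing c⁻¹ on the vertices costs c^n_V.
  rw [h1, det_mul, det_one_add_smul_dartInversion o, det_one_sub_mul_comm, h3, det_smul,
    zpow_sub₀ hc, zpow_natCast, zpow_natCast, nV, ← hcdef]
  field_simp

end Bass

/-! ### Cramer's rule for extracting factors of a determinant -/

section UpdateColumn

variable {V : Type*} [Fintype V] [DecidableEq V]

theorem det_updateCol_mulVec (N : Matrix V V ℂ) (x : V → ℂ) (i : V) :
    det (N.updateCol i (N *ᵥ x)) = det N * x i := by
  rw [← cramer_apply, cramer_eq_adjugate_mulVec, mulVec_mulVec, adjugate_mul, smul_mulVec,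
    one_mulVec, Pi.smul_apply, smul_eq_mul]

theorem updateCol_mulVec_eq (M : Matrix V V ℂ) (i : V) (v y : V → ℂ) :
    M.updateCol i v *ᵥ y = M *ᵥ Function.update y i 0 + y i • v := by
  ext j
  simp only [mulVec, dotProduct, Pi.add_apply, Pi.smul_apply, smul_eq_mul, updateCol_apply]
  rw [Fintype.sum_eq_add_sum_compl i, Fintype.sum_eq_add_sum_compl i (fun k =>
    M j k * Function.update y i 0 k)]
  have : ∀ k ∈ ({i}ᶜ : Finset V), (if k = i then v j else M j k) * y k =
      M j k * Function.update y i 0 k := by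
    intro k hk
    have hk' : k ≠ i := by simpa using hk
    simp [hk']
  rw [Finset.sum_congr rfl this]
  simp
  ring

theorem differentiable_det {N : ℂ → Matrix V V ℂ}
    (h : ∀ i j, Differentiable ℂ fun s => N s i j) : Differentiable ℂ fun s => det (N s) := by
  simp only [det_apply']
  refine Differentiable.fun_sum fun σ _ => ?_
  refine (differentiable_const _).mul ?_
  exact Differentiable.fun_finsetProd fun i _ => h _ _

end UpdateColumn

/-! ### Vanishing order of a perturbed Laplacian determinant -/

section Laplacian

variable {V : Type*} [Fintype V] [DecidableEq V] {G : SimpleGraph V} [DecidableRel G.Adj]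

theorem eq_of_lapMatrix_mulVec_eq_zero (hG : G.Connected) {y : V → ℂ}
    (h : G.lapMatrix ℂ *ᵥ y = 0) (i j : V) : y i = y j := by
  have key : ∀ φ : ℂ →ₗ[ℝ] ℝ, φ (y i) = φ (y j) := by
    intro φ
    have h0 : G.lapMatrix ℝ *ᵥ (fun v => φ (y v)) = 0 := by
      ext v
      have hv := congrArg φ (congrFun h v)
      rw [SimpleGraph.lapMatrix_mulVec_apply, map_sub, map_sum, Pi.zero_apply, map_zero,
        ← nsmul_eq_mul, map_nsmul, nsmul_eq_mul] at hv
      rw [SimpleGraph.lapMatrix_mulVec_apply, hv, Pi.zero_apply]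
    exact (G.lapMatrix_mulVec_eq_zero_iff_forall_reachable.1 h0) i j (hG.preconnected i j)
  exact Complex.ext (key Complex.reLm) (key Complex.imLm)

theorem sum_lapMatrix_mulVec {R : Type*} [CommRing R] (y : V → R) :
    ∑ v, (G.lapMatrix R *ᵥ y) v = 0 := by
  have h : (fun _ => (1 : R)) ⬝ᵥ (G.lapMatrix R *ᵥ y) = 0 := by
    rw [dotProduct_mulVec, ← mulVec_transpose, (G.isSymm_lapMatrix (R := R)).eq,
      G.lapMatrix_mulVec_const_eq_zero, zero_dotProduct]
  simpa [dotProduct] using h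

/-- Columns of the Laplacian sum to zero. For a kernel vector y, summing all rows gives y i · ∑ v =
0; if ∑ v ≠ 0 then y i = 0, so y lies in the kernel of the Laplacian and is constant, hence zero. If
∑ v = 0, the all-ones row vector is a left kernel vector. -/
theorem det_lapMatrix_updateCol_ne_zero_iff (hG : G.Connected) (i : V) (v : V → ℂ) :
    det ((G.lapMatrix ℂ).updateCol i v) ≠ 0 ↔ ∑ w, v w ≠ 0 := by
  rw [not_iff_not, ← exists_mulVec_eq_zero_iff]
  constructor
  · rintro ⟨y, hy, h⟩
    rw [updateCol_mulVec_eq] at h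
    by_contra hv
    have h1 : ∑ w, (G.lapMatrix ℂ *ᵥ Function.update y i 0 + y i • v) w = 0 := by rw [h]; simp
    simp only [Pi.add_apply, Finset.sum_add_distrib, sum_lapMatrix_mulVec, zero_add,
      Pi.smul_apply, smul_eq_mul, ← Finset.mul_sum] at h1
    have hi : y i = 0 := (mul_eq_zero.1 h1).resolve_right hv
    rw [hi, zero_smul, add_zero, ← hi, Function.update_eq_self] at h
    exact hy (funext fun j => (eq_of_lapMatrix_mulVec_eq_zero hG h j i).trans hi)
  · intro hv
    rw [exists_mulVec_eq_zero_iff, ← det_transpose, ← exists_mulVec_eq_zero_iff]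
    refine ⟨fun _ => 1, fun h => one_ne_zero (congrFun h i), ?_⟩
    ext k
    rw [mulVec_transpose]
    simp only [vecMul, dotProduct, one_mul, updateCol_apply, Pi.zero_apply]
    by_cases hk : k = i
    · simpa [hk] using hv
    · have := sum_lapMatrix_mulVec (G := G) (Pi.single k (1 : ℂ))
      simpa [hk] using this

/-- A quadratic perturbation of the Laplacian. -/
noncomputable def lapPencil (G : SimpleGraph V) [DecidableRel G.Adj] (B₁ B₂ : Matrix V V ℂ)
    (s : ℂ) : Matrix V V ℂ :=
  G.lapMatrix ℂ + s • B₁ + s ^ 2 • B₂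

variable (B₁ B₂ : Matrix V V ℂ)

theorem analyticAt_det_lapPencil_updateCol (i : V) (a b : V → ℂ) :
    AnalyticAt ℂ (fun s => det ((lapPencil G B₁ B₂ s).updateCol i (a + s • b))) 0 := by
  refine (differentiable_det fun j k => ?_).analyticAt 0
  simp only [updateCol_apply, lapPencil, Matrix.add_apply, Matrix.smul_apply, smul_eq_mul, Pi.add_apply,
    Pi.smul_apply]
  split_ifs <;> fun_prop

/-- Cramer's rule for the constant vector 1, whose image under the pencil is divisible by s. -/
theorem det_lapPencil_eq (i : V) (s : ℂ) :
    det (lapPencil G B₁ B₂ s) = s * det ((lapPencil G B₁ B₂ s).updateCol i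
      (B₁ *ᵥ (fun _ => 1) + s • (B₂ *ᵥ fun _ => 1))) := by
  have h := det_updateCol_mulVec (lapPencil G B₁ B₂ s) (fun _ => 1) i
  have h1 : lapPencil G B₁ B₂ s *ᵥ (fun _ => 1) =
      s • (B₁ *ᵥ (fun _ => 1) + s • (B₂ *ᵥ fun _ => 1)) := by
    rw [lapPencil, add_mulVec, add_mulVec, G.lapMatrix_mulVec_const_eq_zero, smul_mulVec,
      smul_mulVec, zero_add, smul_add, smul_smul, sq]
  rw [h1, det_updateCol_smul, mul_one] at h
  exact h.symm

/-- Cramer's rule for 1 + s z: the choice of z cancels the term of order s, so the image is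
divisible by s². -/
theorem det_lapPencil_mul_eq (i : V) (s : ℂ) {z : V → ℂ}
    (hz : G.lapMatrix ℂ *ᵥ z = -(B₁ *ᵥ fun _ => 1)) :
    det (lapPencil G B₁ B₂ s) * (1 + s * z i) = s ^ 2 * det ((lapPencil G B₁ B₂ s).updateCol i
      ((B₂ *ᵥ (fun _ => 1) + B₁ *ᵥ z) + s • (B₂ *ᵥ z))) := by
  have h := det_updateCol_mulVec (lapPencil G B₁ B₂ s) ((fun _ => 1) + s • z) i
  have h1 : lapPencil G B₁ B₂ s *ᵥ ((fun _ => 1) + s • z) =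
      s ^ 2 • ((B₂ *ᵥ (fun _ => 1) + B₁ *ᵥ z) + s • (B₂ *ᵥ z)) := by
    simp only [lapPencil, add_mulVec, mulVec_add, mulVec_smul, hz, smul_mulVec,
      G.lapMatrix_mulVec_const_eq_zero]
    module
  rw [h1, det_updateCol_smul] at h
  rw [h]
  simp

theorem lapPencil_zero : lapPencil G B₁ B₂ 0 = G.lapMatrix ℂ := by
  simp [lapPencil]

theorem analyticAt_det_lapPencil : AnalyticAt ℂ (fun s => det (lapPencil G B₁ B₂ s)) 0 := by
  refine (differentiable_det fun j k => ?_).analyticAt 0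
  simp only [lapPencil, Matrix.add_apply, Matrix.smul_apply, smul_eq_mul]
  fun_prop

theorem analyticOrderAt_det_lapPencil_eq_one (hG : G.Connected)
    (h : ∑ v, (B₁ *ᵥ fun _ => 1) v ≠ 0) :
    analyticOrderAt (fun s => det (lapPencil G B₁ B₂ s)) 0 = 1 := by
  obtain ⟨i⟩ := hG.nonempty
  have := ((analyticAt_det_lapPencil (G := G) B₁ B₂).analyticOrderAt_eq_natCast (n := 1)).2
    ⟨_, analyticAt_det_lapPencil_updateCol (G := G) B₁ B₂ i (B₁ *ᵥ fun _ => 1)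
      (B₂ *ᵥ fun _ => 1), ?_, .of_forall fun s => ?_⟩
  · exact_mod_cast this
  · simp only [zero_smul, add_zero, lapPencil_zero]
    exact (det_lapMatrix_updateCol_ne_zero_iff hG i _).2 h
  · rw [sub_zero, pow_one, smul_eq_mul]
    exact det_lapPencil_eq B₁ B₂ i s

theorem two_le_analyticOrderAt_det_lapPencil (hG : G.Connected)
    (h : ∑ v, (B₁ *ᵥ fun _ => 1) v = 0) :
    2 ≤ analyticOrderAt (fun s => det (lapPencil G B₁ B₂ s)) 0 := by
  obtain ⟨i⟩ := hG.nonempty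
  have hA := analyticAt_det_lapPencil_updateCol (G := G) B₁ B₂ i (B₁ *ᵥ fun _ => 1)
    (B₂ *ᵥ fun _ => 1)
  have h0 : (fun s => det ((lapPencil G B₁ B₂ s).updateCol i
      (B₁ *ᵥ (fun _ => 1) + s • (B₂ *ᵥ fun _ => 1)))) 0 = 0 := by
    simp only [zero_smul, add_zero, lapPencil_zero]
    exact not_not.1 fun hne => (det_lapMatrix_updateCol_ne_zero_iff hG i _).1 hne h
  have h1 : (fun s => det (lapPencil G B₁ B₂ s)) = id * fun s =>
      det ((lapPencil G B₁ B₂ s).updateCol i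
        (B₁ *ᵥ (fun _ => 1) + s • (B₂ *ᵥ fun _ => 1))) :=
    funext fun s => det_lapPencil_eq B₁ B₂ i s
  rw [h1, analyticOrderAt_mul analyticAt_id hA, ← one_add_one_eq_two]
  refine add_le_add ?_ ?_
  · exact Order.one_le_iff_ne_zero.2 (analyticAt_id.analyticOrderAt_ne_zero.2 rfl)
  · exact Order.one_le_iff_ne_zero.2 (hA.analyticOrderAt_ne_zero.2 h0)

theorem analyticOrderAt_det_lapPencil_eq_two (hG : G.Connected) {z : V → ℂ}
    (hz : G.lapMatrix ℂ *ᵥ z = -(B₁ *ᵥ fun _ => 1))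
    (h : ∑ v, (B₂ *ᵥ (fun _ => 1) + B₁ *ᵥ z) v ≠ 0) :
    analyticOrderAt (fun s => det (lapPencil G B₁ B₂ s)) 0 = 2 := by
  obtain ⟨i⟩ := hG.nonempty
  have hA := analyticAt_det_lapPencil_updateCol (G := G) B₁ B₂ i (B₂ *ᵥ (fun _ => 1) + B₁ *ᵥ z)
    (B₂ *ᵥ z)
  have hlin : AnalyticAt ℂ (fun s : ℂ => 1 + s * z i) 0 := by fun_prop
  have hlin0 : (fun s : ℂ => 1 + s * z i) 0 ≠ 0 := by simp
  have h1 : (fun s => det (lapPencil G B₁ B₂ s)) =ᶠ[𝓝 0] fun s => (s - 0) ^ 2 •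
      (det ((lapPencil G B₁ B₂ s).updateCol i
        ((B₂ *ᵥ (fun _ => 1) + B₁ *ᵥ z) + s • (B₂ *ᵥ z))) / (1 + s * z i)) := by
    filter_upwards [hlin.continuousAt.eventually_ne hlin0] with s hs
    rw [sub_zero, smul_eq_mul, ← mul_div_assoc, ← det_lapPencil_mul_eq B₁ B₂ i s hz,
      mul_div_cancel_right₀ _ hs]
  have := ((analyticAt_det_lapPencil (G := G) B₁ B₂).analyticOrderAt_eq_natCast (n := 2)).2
    ⟨_, hA.div hlin hlin0, ?_, h1⟩
  · exact_mod_cast this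
  · refine div_ne_zero ?_ hlin0
    simp only [zero_smul, add_zero, lapPencil_zero]
    exact (det_lapMatrix_updateCol_ne_zero_iff hG i _).2 h

end Laplacian

/-! ### The vertex determinant at q = 1/t -/

section BassOrder

variable {V : Type*} [Fintype V] {G : SimpleGraph V} [DecidableRel G.Adj]

theorem sum_degree_cast : ∑ v, (G.degree v : ℂ) = 2 * nE G := by
  rw [nE]
  exact_mod_cast G.sum_degrees_eq_twice_card_edges

variable [DecidableEq V]

/-- First order coefficient of `t • bassMatrix G t q` at `q = 1 / t`. -/
noncomputable def bassFirst (G : SimpleGraph V) [DecidableRel G.Adj] (t : ℂ) : Matrix V V ℂ :=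
  G.lapMatrix ℂ + G.degMatrix ℂ - (2 * t) • 1

/-- Second order coefficient of `t • bassMatrix G t q` at `q = 1 / t`. -/
noncomputable def bassSecond (G : SimpleGraph V) [DecidableRel G.Adj] (t : ℂ) : Matrix V V ℂ :=
  G.degMatrix ℂ - t • 1

theorem smul_bassMatrix_eq (t q : ℂ) :
    t • bassMatrix G t q = lapPencil G (bassFirst G t) (bassSecond G t) (t * q - 1) := by
  have h1 : t * (t * q ^ 2) = (t * q) ^ 2 := by ring
  rw [bassMatrix, lapPencil, bassFirst, bassSecond, SimpleGraph.lapMatrix, smul_add, smul_smul, h1]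
  module

theorem analyticAt_det_bassMatrix (t q₀ : ℂ) :
    AnalyticAt ℂ (fun q => det (bassMatrix G t q)) q₀ := by
  refine (differentiable_det fun j k => ?_).analyticAt _
  simp only [bassMatrix, Matrix.add_apply, Matrix.sub_apply, Matrix.smul_apply, smul_eq_mul]
  fun_prop

/-- The substitution s = tq - 1 has nonzero derivative, and rescaling the matrix by t changes the
determinant by a nonzero constant. -/
theorem analyticOrderAt_det_bassMatrix {t : ℂ} (ht : t ≠ 0) :
    analyticOrderAt (fun q => det (bassMatrix G t q)) t⁻¹ =
      analyticOrderAt (fun s => det (lapPencil G (bassFirst G t) (bassSecond G t) s)) 0 := by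
  set F := fun s => det (lapPencil G (bassFirst G t) (bassSecond G t) s) with hF
  let g : ℂ → ℂ := fun q => t * q - 1
  have hg0 : g t⁻¹ = 0 := by simp [g, ht]
  have hgA : AnalyticAt ℂ g t⁻¹ := by fun_prop
  have hgd : deriv g t⁻¹ ≠ 0 := by
    have : HasDerivAt g t t⁻¹ := by
      have h := ((hasDerivAt_id t⁻¹).const_mul t).sub_const 1
      rw [mul_one] at h
      exact h
    rw [this.deriv]
    exact ht
  have h1 : F ∘ g = (fun _ => t ^ Fintype.card V) * fun q => det (bassMatrix G t q) := by
    funext q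
    simp only [hF, Function.comp, g, Pi.mul_apply]
    rw [← smul_bassMatrix_eq, det_smul]
  rw [← hg0, ← analyticOrderAt_comp_of_deriv_ne_zero hgA hgd, h1,
    analyticOrderAt_mul analyticAt_const (analyticAt_det_bassMatrix t _),
    analyticAt_const.analyticOrderAt_eq_zero.2 (pow_ne_zero _ ht), zero_add]

theorem bassFirst_mulVec (t : ℂ) (y : V → ℂ) :
    bassFirst G t *ᵥ y = G.lapMatrix ℂ *ᵥ y + fun v => (G.degree v - 2 * t) * y v := by
  ext v
  rw [bassFirst, sub_mulVec, add_mulVec, smul_mulVec, one_mulVec]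
  simp only [Pi.sub_apply, Pi.add_apply, SimpleGraph.degMatrix_mulVec_apply, Pi.smul_apply,
    smul_eq_mul]
  ring

theorem bassSecond_mulVec_one (t : ℂ) :
    bassSecond G t *ᵥ (fun _ => 1) = fun v => (G.degree v - t : ℂ) := by
  ext v
  rw [bassSecond, sub_mulVec, smul_mulVec, one_mulVec]
  simp only [Pi.sub_apply, SimpleGraph.degMatrix_mulVec_apply, Pi.smul_apply, smul_eq_mul, mul_one]

theorem sum_bassFirst (t : ℂ) :
    ∑ v, (bassFirst G t *ᵥ fun _ => 1) v = 2 * (nE G - t * nV G) := by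
  rw [bassFirst_mulVec, G.lapMatrix_mulVec_const_eq_zero]
  simp only [Pi.add_apply, Pi.zero_apply, zero_add, mul_one, Finset.sum_sub_distrib,
    sum_degree_cast, Finset.sum_const, Finset.card_univ, nsmul_eq_mul, nV]
  ring

theorem analyticOrderAt_det_bassMatrix_eq_one (hG : G.Connected) {t : ℂ} (ht : t ≠ 0)
    (h : nE G - t * nV G ≠ 0) :
    analyticOrderAt (fun q => det (bassMatrix G t q)) t⁻¹ = 1 := by
  rw [analyticOrderAt_det_bassMatrix ht]
  apply analyticOrderAt_det_lapPencil_eq_one _ _ hG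
  rw [sum_bassFirst]
  exact mul_ne_zero two_ne_zero h

theorem two_le_analyticOrderAt_det_bassMatrix (hG : G.Connected) {t : ℂ} (ht : t ≠ 0)
    (h : nE G - t * nV G = 0) :
    2 ≤ analyticOrderAt (fun q => det (bassMatrix G t q)) t⁻¹ := by
  rw [analyticOrderAt_det_bassMatrix ht]
  apply two_le_analyticOrderAt_det_lapPencil _ _ hG
  rw [sum_bassFirst, h, mul_zero]

theorem analyticOrderAt_det_bassMatrix_eq_two (hG : G.Connected) {t : ℂ} (ht : t ≠ 0)
    (h : nE G - t * nV G = 0) {z : V → ℂ}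
    (hz : G.lapMatrix ℂ *ᵥ z = fun v => 2 * t - G.degree v)
    (hne : nE G + ∑ v, (G.degree v - 2 * t) * z v ≠ 0) :
    analyticOrderAt (fun q => det (bassMatrix G t q)) t⁻¹ = 2 := by
  rw [analyticOrderAt_det_bassMatrix ht]
  refine analyticOrderAt_det_lapPencil_eq_two _ _ hG (z := z) ?_ ?_
  · rw [hz, bassFirst_mulVec, G.lapMatrix_mulVec_const_eq_zero]
    ext v
    simp
  · convert! hne using 1
    rw [bassSecond_mulVec_one, bassFirst_mulVec]
    simp only [Pi.add_apply, Finset.sum_add_distrib, sum_lapMatrix_mulVec, zero_add,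
      Finset.sum_sub_distrib, sum_degree_cast, Finset.sum_const, Finset.card_univ, nsmul_eq_mul]
    congr 1
    -- The sum of B₂1 is 2 n_E - t n_V, which equals n_E because t n_V = n_E.
    rw [nV] at h
    linear_combination h

end BassOrder

/-! ### The second coefficient and the Moore–Penrose inverse -/

section MoorePenroseDegree

variable {V : Type*} [Fintype V] [DecidableEq V] {G : SimpleGraph V}

theorem incidence_mulVec (o : EdgeDirection G) (y : V → ℝ) (e : G.edgeSet) :
    (incidence o *ᵥ y) e = y (o.dart e).snd - y (o.dart e).fst := by
  have hne := (o.dart e).fst_ne_snd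
  have h : ∀ v, incidence o e v * y v =
      (if v = (o.dart e).snd then y v else 0) - (if v = (o.dart e).fst then y v else 0) := by
    intro v
    simp only [incidence, Matrix.of_apply]
    split_ifs with h1 h2
    · exact absurd (h2.symm.trans h1) hne
    · simp
    · simp
    · simp
  simp only [mulVec, dotProduct, h, Finset.sum_sub_distrib, Finset.sum_ite_eq', Finset.mem_univ,
    if_true]

variable [DecidableRel G.Adj]

theorem incidence_transpose_mulVec_incidence_mulVec (o : EdgeDirection G) (y : V → ℝ) :
    (incidence o)ᵀ *ᵥ (incidence o *ᵥ y) = G.lapMatrix ℝ *ᵥ y := by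
  ext v
  rw [SimpleGraph.lapMatrix_mulVec_apply, ← SimpleGraph.card_neighborFinset_eq_degree,
    ← nsmul_eq_mul, ← Finset.sum_const, ← Finset.sum_sub_distrib,
    ← sum_dart_fst v (fun w => y v - y w), o.sum_dart]
  simp only [mulVec, dotProduct, Matrix.transpose_apply]
  refine Finset.sum_congr rfl fun e _ => ?_
  have h2 : ∑ j, incidence o e j * y j = _ := incidence_mulVec o y e
  rw [h2]
  have hne := (o.dart e).fst_ne_snd
  simp only [incidence, Matrix.of_apply]
  simp only [SimpleGraph.Dart.symm_toProd, Prod.fst_swap, Prod.snd_swap]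
  by_cases h1 : v = (o.dart e).snd
  · subst h1
    simp [hne]
  · by_cases h3 : v = (o.dart e).fst
    · subst h3
      simp [hne, Ne.symm hne]
    · simp [h1, h3, Ne.symm h1, Ne.symm h3]

/-- The potential `-L⁺ (L⁺)ᵀ d` solves the Poisson equation for the centred degree vector. -/
theorem exists_lapMatrix_mulVec_eq (hG : G.Connected) (o : EdgeDirection G) :
    ∃ z : V → ℝ, (G.lapMatrix ℝ *ᵥ z = fun v => (2 * nE G / nV G - G.degree v : ℝ)) ∧
      ∑ v, (G.degree v - 2 * nE G / nV G : ℝ) * z v = -normSqPinvDegree o := by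
  obtain ⟨i⟩ := hG.nonempty
  set L := incidence o with hL
  set P := moorePenrose L with hP
  have hMP : IsMoorePenroseInverse L P := moorePenrose_spec L
  set d : V → ℝ := degreeVector G with hd
  have hL1 : L *ᵥ (fun _ => 1) = 0 := by
    ext e
    rw [incidence_mulVec]
    simp
  have hn : (nV G : ℝ) ≠ 0 := by
    have : Nonempty V := ⟨i⟩
    exact Nat.cast_ne_zero.2 Fintype.card_ne_zero
  -- the projection `P L d` differs from `d` by a constant
  have hproj : ∀ v, ((P * L) *ᵥ d) v = d v - 2 * nE G / nV G := by
    set y := d - (P * L) *ᵥ d with hy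
    have hLy : L *ᵥ y = 0 := by
      rw [hy, mulVec_sub, mulVec_mulVec, ← Matrix.mul_assoc, hMP.mul_mul_self, sub_self]
    have hlap : G.lapMatrix ℝ *ᵥ y = 0 := by
      rw [← incidence_transpose_mulVec_incidence_mulVec o, ← hL, hLy, mulVec_zero]
    have hconst : ∀ v, y v = y i := fun v =>
      (G.lapMatrix_mulVec_eq_zero_iff_forall_reachable.1 hlap) v i (hG.preconnected v i)
    -- PL is symmetric and kills constants, so PLd sums to zero. The constant value of y is
    -- therefore the mean degree.
    have hsum : ∑ v, y v = 2 * nE G := by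
      have h1 : (fun _ => (1 : ℝ)) ⬝ᵥ ((P * L) *ᵥ d) = 0 := by
        rw [dotProduct_mulVec, ← mulVec_transpose, hMP.symm_left, ← mulVec_mulVec, hL1,
          mulVec_zero, zero_dotProduct]
      have h2 : ∑ v, d v = 2 * nE G := by
        simp only [hd, degreeVector, nE]
        exact_mod_cast G.sum_degrees_eq_twice_card_edges
      simp only [dotProduct, one_mul] at h1
      simp only [hy, Pi.sub_apply, Finset.sum_sub_distrib, h1, h2, sub_zero]
    have hyi : y i = 2 * nE G / nV G := by
      simp only [hconst, Finset.sum_const, Finset.card_univ, nsmul_eq_mul] at hsum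
      rw [eq_div_iff hn, mul_comm]
      exact hsum
    intro v
    have := hconst v
    rw [hyi, hy, Pi.sub_apply] at this
    linarith
  set a := Pᵀ *ᵥ d with ha
  refine ⟨-(P *ᵥ a), ?_, ?_⟩
  · rw [mulVec_neg, ← incidence_transpose_mulVec_incidence_mulVec o, ← hL]
    -- Symmetry of LP gives LᵀLP = (LPL)ᵀ = Lᵀ, and then LᵀPᵀ = (PL)ᵀ = PL.
    have h1 : Lᵀ *ᵥ (L *ᵥ (P *ᵥ a)) = (P * L) *ᵥ d := by
      rw [ha, mulVec_mulVec, mulVec_mulVec, mulVec_mulVec, ← hMP.symm_left]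
      congr 1
      rw [Matrix.mul_assoc Lᵀ, ← hMP.symm_right, ← Matrix.transpose_mul, hMP.mul_mul_self,
        ← Matrix.transpose_mul]
    rw [h1]
    ext v
    rw [Pi.neg_apply, hproj]
    simp only [hd, degreeVector]
    ring
  · have h1 : (fun v => (G.degree v - 2 * nE G / nV G : ℝ)) = (P * L) *ᵥ d := by
      ext v
      rw [hproj]
      rfl
    have h2 : ∑ v, (G.degree v - 2 * nE G / nV G : ℝ) * (-(P *ᵥ a)) v =
        ((P * L) *ᵥ d) ⬝ᵥ (-(P *ᵥ a)) := by
      rw [← h1]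
      rfl
    -- Here Pᵀ(PL) = (PLP)ᵀ = Pᵀ, by symmetry of PL.
    have h3 : ((P * L) *ᵥ d) ⬝ᵥ (P *ᵥ a) = a ⬝ᵥ a := by
      rw [dotProduct_mulVec, ← mulVec_transpose, mulVec_mulVec, ← hMP.symm_left,
        ← Matrix.transpose_mul, hMP.self_mul_mul]
    rw [h2, dotProduct_neg, h3, normSqPinvDegree, dotProduct]
    simp only [sq]
    rfl

theorem analyticOrderAt_det_bassMatrix_eq_two_of_normSq (hG : G.Connected) (o : EdgeDirection G)
    {t : ℂ} (ht : t ≠ 0) (h : nE G - t * nV G = 0) (hne : normSqPinvDegree o ≠ nE G) :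
    analyticOrderAt (fun q => det (bassMatrix G t q)) t⁻¹ = 2 := by
  obtain ⟨z, hz, hz'⟩ := exists_lapMatrix_mulVec_eq hG o
  have hn : (nV G : ℂ) ≠ 0 := by
    have := hG.nonempty
    exact Nat.cast_ne_zero.2 Fintype.card_ne_zero
  have ht2 : 2 * t = ((2 * nE G / nV G : ℝ) : ℂ) := by
    push_cast
    rw [eq_div_iff hn]
    linear_combination -2 * h
  refine analyticOrderAt_det_bassMatrix_eq_two hG ht h (z := fun v => (z v : ℂ)) ?_ ?_
  · ext v
    have := congrArg (Complex.ofReal) (congrFun hz v)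
    rw [SimpleGraph.lapMatrix_mulVec_apply] at this
    rw [SimpleGraph.lapMatrix_mulVec_apply, ht2]
    exact_mod_cast this
  · rw [ht2]
    have := congrArg (Complex.ofReal) hz'
    push_cast at this ⊢
    rw [this]
    intro h0
    apply hne
    have : (nE G : ℂ) = normSqPinvDegree o := by linear_combination h0
    exact_mod_cast this.symm

end MoorePenroseDegree

/-! ### The signless Laplacian of a non-bipartite graph -/

section SignlessLaplacian

variable {V : Type*} [Fintype V] [DecidableEq V] {G : SimpleGraph V} [DecidableRel G.Adj]

theorem dotProduct_signless_mulVec (x : V → ℝ) :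
    2 * (x ⬝ᵥ ((G.degMatrix ℝ + G.adjMatrix ℝ) *ᵥ x)) =
      ∑ i, ∑ j, if G.Adj i j then (x i + x j) ^ 2 else 0 := by
  have h1 : x ⬝ᵥ ((G.degMatrix ℝ + G.adjMatrix ℝ) *ᵥ x) =
      ∑ i, ∑ j, if G.Adj i j then x i * (x i + x j) else 0 := by
    rw [dotProduct]
    refine Finset.sum_congr rfl fun i _ => ?_
    rw [add_mulVec, Pi.add_apply, SimpleGraph.degMatrix_mulVec_apply,
      SimpleGraph.adjMatrix_mulVec_apply, ← SimpleGraph.card_neighborFinset_eq_degree,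
      ← nsmul_eq_mul, ← Finset.sum_const, ← Finset.sum_add_distrib, Finset.mul_sum,
      SimpleGraph.neighborFinset_eq_filter, Finset.sum_filter]
  have h2 : x ⬝ᵥ ((G.degMatrix ℝ + G.adjMatrix ℝ) *ᵥ x) =
      ∑ i, ∑ j, if G.Adj i j then x j * (x i + x j) else 0 := by
    rw [h1, Finset.sum_comm]
    refine Finset.sum_congr rfl fun i _ => Finset.sum_congr rfl fun j _ => ?_
    simp only [G.adj_comm j i, add_comm (x j)]
  rw [two_mul]
  nth_rewrite 1 [h1]
  rw [h2, ← Finset.sum_add_distrib]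
  refine Finset.sum_congr rfl fun i _ => ?_
  rw [← Finset.sum_add_distrib]
  refine Finset.sum_congr rfl fun j _ => ?_
  split_ifs
  · ring
  · simp

/-- The signless Laplacian of a connected graph that is not bipartite is nonsingular. -/
theorem det_signless_ne_zero (hG : G.Connected) (hb : ¬ G.IsBipartite) :
    det (G.degMatrix ℂ + G.adjMatrix ℂ) ≠ 0 := by
  have hreal : det (G.degMatrix ℝ + G.adjMatrix ℝ) ≠ 0 := by
    intro h0
    obtain ⟨x, hx, hx0⟩ := exists_mulVec_eq_zero_iff.2 h0
    have hsum := dotProduct_signless_mulVec (G := G) x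
    rw [hx0, dotProduct_zero, mul_zero] at hsum
    -- The quadratic form is a sum of squares (x i + x j)² over adjacent pairs, so x changes sign
    -- along edges. By connectedness x vanishes nowhere, and its sign is a 2-colouring.
    have hadj : ∀ i j, G.Adj i j → x j = -x i := by
      intro i j hij
      have hnn : ∀ i j, 0 ≤ if G.Adj i j then (x i + x j) ^ 2 else 0 := by
        intro i j
        split_ifs <;> positivity
      have h1 := (Finset.sum_eq_zero_iff_of_nonneg
        (fun i _ => Finset.sum_nonneg fun j _ => hnn i j)).1 hsum.symm i (Finset.mem_univ i)
      have h2 := (Finset.sum_eq_zero_iff_of_nonneg (fun j _ => hnn i j)).1 h1 j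
        (Finset.mem_univ j)
      rw [if_pos hij, sq_eq_zero_iff] at h2
      linarith
    have hne : ∀ i, x i ≠ 0 := by
      intro i hi
      apply hx
      funext j
      obtain ⟨w⟩ := hG.preconnected i j
      induction w with
      | nil => exact hi
      | cons hab _ ih => exact ih (by rw [hadj _ _ hab, hi, neg_zero])
    apply hb
    refine ⟨SimpleGraph.Coloring.mk (fun v => if 0 < x v then (0 : Fin 2) else 1) ?_⟩
    intro v w hvw
    have h1 := hadj v w hvw
    rcases lt_or_gt_of_ne (hne v) with h | h
    · have h2 : 0 < x w := by linarith
      simp [h.not_gt, h2]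
    · have h2 : ¬ 0 < x w := by linarith
      simp [h, h2]
  have hmap : (G.degMatrix ℂ + G.adjMatrix ℂ) =
      Complex.ofRealHom.mapMatrix (G.degMatrix ℝ + G.adjMatrix ℝ) := by
    ext i j
    simp only [SimpleGraph.degMatrix, Matrix.add_apply, SimpleGraph.adjMatrix_apply,
      RingHom.mapMatrix_apply, Matrix.map_apply, Matrix.diagonal_apply]
    split_ifs <;> simp
  rw [hmap, ← RingHom.map_det]
  exact (map_ne_zero _).2 hreal

theorem det_bassMatrix_neg_inv_ne_zero (hG : G.Connected) (hb : ¬ G.IsBipartite) {t : ℂ}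
    (ht : t ≠ 0) : det (bassMatrix G t (-t⁻¹)) ≠ 0 := by
  have h : bassMatrix G t (-t⁻¹) = t⁻¹ • (G.degMatrix ℂ + G.adjMatrix ℂ) := by
    have h1 : t * (-t⁻¹) ^ 2 = t⁻¹ := by field_simp
    rw [bassMatrix, h1, smul_sub, smul_smul, inv_mul_cancel₀ ht]
    module
  rw [h, det_smul]
  exact mul_ne_zero (pow_ne_zero _ (inv_ne_zero ht)) (det_signless_ne_zero hG hb)

end SignlessLaplacian

/-! ### Identity theorem for meromorphic functions -/

section IdentityTheorem

theorem eventuallyEq_nhdsNE_of_eventuallyEq_nhds {f g : ℂ → ℂ} (hf : MeromorphicOn f Set.univ)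
    (hg : MeromorphicOn g Set.univ) {z₀ : ℂ} (h : f =ᶠ[𝓝 z₀] g) (z : ℂ) :
    f =ᶠ[𝓝[≠] z] g := by
  have hz₀ : meromorphicOrderAt (f - g) z₀ = ⊤ := by
    rw [meromorphicOrderAt_eq_top_iff]
    filter_upwards [h.filter_mono nhdsWithin_le_nhds] with q hq
    rw [Pi.sub_apply, hq, sub_self]
  have hz : meromorphicOrderAt (f - g) z = ⊤ := by
    by_contra hne
    exact (hf.sub hg).meromorphicOrderAt_ne_top_of_isPreconnected isPreconnected_univ
      (Set.mem_univ z) (Set.mem_univ z₀) hne hz₀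
  filter_upwards [meromorphicOrderAt_eq_top_iff.1 hz] with q hq
  exact sub_eq_zero.1 hq

theorem eventuallyEq_codiscrete_of_eventuallyEq_nhds {f g : ℂ → ℂ}
    (hf : MeromorphicOn f Set.univ) (hg : MeromorphicOn g Set.univ) {z₀ : ℂ}
    (h : f =ᶠ[𝓝 z₀] g) : f =ᶠ[codiscrete ℂ] g := by
  rw [Filter.EventuallyEq, Filter.Eventually, mem_codiscrete]
  intro z
  rw [disjoint_principal_right, compl_compl]
  exact eventuallyEq_nhdsNE_of_eventuallyEq_nhds hf hg h z

end IdentityTheorem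

/-! ### Uniqueness of the continuation -/

section ZetaUniqueness

variable {V : Type*} [DecidableEq V] {G : SimpleGraph V}

theorem IsBartholdiZeta.eventuallyEq {u : ℂ} {Z Z' : ℂ → ℂ} (h : IsBartholdiZeta G u Z)
    (h' : IsBartholdiZeta G u Z') : Z =ᶠ[𝓝 0] Z' := by
  filter_upwards [h.2, h'.2] with q hq hq'
  exact hq.unique hq'

theorem IsBartholdiZeta.meromorphicOn_neg {u : ℂ} {Z : ℂ → ℂ}
    (h : IsBartholdiZeta G u Z) : MeromorphicOn (fun q => Z (-q)) Set.univ := fun q _ =>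
  (h.1 (-q) (Set.mem_univ _)).comp_analyticAt (f := Z) (g := fun q => -q) (by fun_prop)

end ZetaUniqueness

/-! ### Critical value and edge counts -/

section GraphCounts

variable {V : Type*} [Fintype V] {G : SimpleGraph V} [DecidableRel G.Adj]

theorem eq_uStar_iff (hG : G.Connected) (u : ℂ) :
    u = uStar G ↔ (nE G : ℂ) - (1 - u) * nV G = 0 := by
  have hn : (nV G : ℂ) ≠ 0 := by
    have := hG.nonempty
    exact Nat.cast_ne_zero.2 Fintype.card_ne_zero
  rw [uStar]
  constructor
  · rintro rfl
    field_simp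
    ring
  · intro h
    field_simp
    linear_combination h

theorem nV_le_nE_add_one (hG : G.Connected) : nV G ≤ nE G + 1 := by
  have := hG.card_vert_le_card_edgeSet_add_one
  rwa [Nat.card_eq_fintype_card, Nat.card_eq_fintype_card, ← SimpleGraph.edgeFinset_card] at this

theorem isTree_iff_nE_add_one_eq (hG : G.Connected) : G.IsTree ↔ nE G + 1 = nV G := by
  rw [SimpleGraph.isTree_iff_connected_and_card, Nat.card_eq_fintype_card,
    Nat.card_eq_fintype_card, ← SimpleGraph.edgeFinset_card]
  exact and_iff_right hG

end GraphCounts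

/-! ### Evenness and orders of the zeta function -/

section ZetaFunction

variable {V : Type*} [Fintype V] [DecidableEq V] {G : SimpleGraph V} [DecidableRel G.Adj]

/-- The determinant whose inverse is the Bartholdi zeta function. -/
noncomputable def zetaDet (G : SimpleGraph V) [DecidableRel G.Adj] (u q : ℂ) : ℂ :=
  det (1 - q • Matrix.of (dartWeight (G := G) u))

theorem analyticAt_zetaDet (u q₀ : ℂ) : AnalyticAt ℂ (zetaDet G u) q₀ := by
  refine (differentiable_det fun j k => ?_).analyticAt _
  simp only [Matrix.sub_apply, Matrix.smul_apply, smul_eq_mul]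
  fun_prop

theorem isBartholdiZeta_inv_zetaDet (u : ℂ) : IsBartholdiZeta G u (zetaDet G u)⁻¹ :=
  ⟨fun q _ => (analyticAt_zetaDet u q).meromorphicAt.inv, eventually_hasProd_inv_det u⟩

/-- Conjugating W by the sign of the colour of the source vertex gives -W, since consecutive darts
start at vertices of opposite colours. -/
theorem zetaDet_neg (hb : G.IsBipartite) (u q : ℂ) : zetaDet G u (-q) = zetaDet G u q := by
  obtain ⟨C⟩ := hb
  let ε : V → ℂ := fun v => if C v = 0 then 1 else -1
  have hε : ∀ v, ε v * ε v = 1 := by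
    intro v
    simp only [ε]
    split_ifs <;> norm_num
  have hadj : ∀ v w, G.Adj v w → ε v * ε w = -1 := by
    intro v w hvw
    have hne := C.valid hvw
    simp only [ε]
    by_cases h1 : C v = 0 <;> by_cases h2 : C w = 0
    · exact absurd (h1.trans h2.symm) hne
    · simp [h1, h2]
    · simp [h1, h2]
    · exact absurd (by omega) hne
  let S : Matrix G.Dart G.Dart ℂ := diagonal fun e => ε e.fst
  have hS : S * S = 1 := by
    simp only [S, diagonal_mul_diagonal, hε, diagonal_one]
  have hSW : S * Matrix.of (dartWeight u) * S = -Matrix.of (dartWeight (G := G) u) := by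
    ext e f
    simp only [S, mul_diagonal, diagonal_mul, Matrix.of_apply, Matrix.neg_apply]
    by_cases h : e.snd = f.fst
    · have := hadj _ _ e.adj
      rw [← h]
      linear_combination (dartWeight u e f) * this
    · simp [dartWeight, h]
  have h1 : S * (1 - q • Matrix.of (dartWeight (G := G) u)) * S =
      1 - (-q) • Matrix.of (dartWeight (G := G) u) := by
    rw [Matrix.mul_sub, Matrix.sub_mul, Matrix.mul_one, hS, Matrix.mul_smul, Matrix.smul_mul, hSW,
      smul_neg, neg_smul]
  have hdet : det S * det S = 1 := by rw [← det_mul, hS, det_one]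
  rw [zetaDet, zetaDet, ← h1, det_mul, det_mul]
  linear_combination det (1 - q • Matrix.of (dartWeight (G := G) u)) * hdet

theorem IsBartholdiZeta.eventuallyEq_neg (hb : G.IsBipartite) {u : ℂ} {Z : ℂ → ℂ}
    (h : IsBartholdiZeta G u Z) : (fun q => Z (-q)) =ᶠ[𝓝 0] Z := by
  have h0 := h.eventuallyEq (isBartholdiZeta_inv_zetaDet u)
  have hneg : Tendsto (fun q : ℂ => -q) (𝓝 0) (𝓝 0) := by
    simpa using (continuous_neg (G := ℂ)).tendsto 0
  filter_upwards [h0, hneg.eventually h0] with q hq hq'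
  rw [hq, hq', Pi.inv_apply, Pi.inv_apply, zetaDet_neg hb]

theorem IsBartholdiZeta.meromorphicOrderAt_neg (hb : G.IsBipartite) {u : ℂ} {Z : ℂ → ℂ}
    (h : IsBartholdiZeta G u Z) (z : ℂ) :
    meromorphicOrderAt Z (-z) = meromorphicOrderAt Z z := by
  have h1 : meromorphicOrderAt (Z ∘ fun q => -q) z = meromorphicOrderAt Z (-z) :=
    meromorphicOrderAt_comp_of_deriv_ne_zero (g := fun q : ℂ => -q) (by fun_prop) (by simp)
  rw [← h1]
  exact meromorphicOrderAt_congr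
    (eventuallyEq_nhdsNE_of_eventuallyEq_nhds h.meromorphicOn_neg h.1 (h.eventuallyEq_neg hb) z)

theorem analyticOrderAt_one_sub_sq {t z : ℂ} (hz : (t * z) ^ 2 = 1) :
    analyticOrderAt (fun q => 1 - (t * q) ^ 2) z = 1 := by
  have ht : t ≠ 0 := by
    rintro rfl
    simp at hz
  have hz0 : z ≠ 0 := by
    rintro rfl
    simp at hz
  have hA : AnalyticAt ℂ (fun q => 1 - (t * q) ^ 2) z := by fun_prop
  have := (hA.analyticOrderAt_eq_natCast (n := 1)).2
    -- From (tz)² = 1 follows 1 - (tq)² = -t²(q - z)(q + z), and z ≠ -z.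
    ⟨fun q => -t ^ 2 * (q + z), by fun_prop, ?_, .of_forall fun q => ?_⟩
  · exact_mod_cast this
  · have : z + z ≠ 0 := by
      rw [← two_mul]
      exact mul_ne_zero two_ne_zero hz0
    exact mul_ne_zero (neg_ne_zero.2 (pow_ne_zero _ ht)) this
  · rw [smul_eq_mul, ← hz]
    ring

/-- The determinant is entire in q and equals 1 at q = 0. -/
theorem analyticOrderAt_det_bassMatrix_ne_top (t z : ℂ) :
    analyticOrderAt (fun q => det (bassMatrix G t q)) z ≠ ⊤ := by
  intro h
  have hA : AnalyticOnNhd ℂ (fun q => det (bassMatrix G t q)) Set.univ := fun q _ =>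
    analyticAt_det_bassMatrix t q
  have h0 := hA.eq_of_eventuallyEq (g := fun _ => 0) (fun _ _ => analyticAt_const)
    (analyticOrderAt_eq_top.1 h)
  have := congrFun h0 0
  simp [bassMatrix] at this

/-- The order of the zeta function at `± 1 / (1 - u)` in terms of Bass' vertex determinant. -/
theorem IsBartholdiZeta.exists_meromorphicOrderAt_eq (o : EdgeDirection G) {u : ℂ} {Z : ℂ → ℂ}
    (h : IsBartholdiZeta G u Z) {z : ℂ} (hz : ((1 - u) * z) ^ 2 = 1) :
    ∃ m : ℕ, analyticOrderAt (fun q => det (bassMatrix G (1 - u) q)) z = m ∧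
      meromorphicOrderAt Z z = ((-((nE G : ℤ) - nV G + m) : ℤ) : WithTop ℤ) := by
  obtain ⟨m, hm⟩ := ENat.ne_top_iff_exists.1
    (analyticOrderAt_det_bassMatrix_ne_top (G := G) (1 - u) z)
  refine ⟨m, hm.symm, ?_⟩
  have hcA : AnalyticAt ℂ (fun q => 1 - ((1 - u) * q) ^ 2) z := by fun_prop
  have hc1 : meromorphicOrderAt (fun q => 1 - ((1 - u) * q) ^ 2) z = 1 := by
    rw [hcA.meromorphicOrderAt_eq, analyticOrderAt_one_sub_sq hz]
    rfl
  have hBA := analyticAt_det_bassMatrix (G := G) (1 - u) z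
  have hB : meromorphicOrderAt (fun q => det (bassMatrix G (1 - u) q)) z =
      ((m : ℤ) : WithTop ℤ) := by
    rw [hBA.meromorphicOrderAt_eq, ← hm]
    rfl
  have hcne : ∀ᶠ q in 𝓝[≠] z, 1 - ((1 - u) * q) ^ 2 ≠ 0 :=
    (meromorphicOrderAt_ne_top_iff_eventually_ne_zero hcA.meromorphicAt).1 (by rw [hc1]; simp)
  -- Bass' formula needs 1 - (tq)² ≠ 0, so it holds only on a punctured neighbourhood. The exponent
  -- n_E - n_V is an integer, equal to -1 for trees.
  have hdet : zetaDet G u =ᶠ[𝓝[≠] z]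
      (fun q => 1 - ((1 - u) * q) ^ 2) ^ ((nE G : ℤ) - nV G) *
        fun q => det (bassMatrix G (1 - u) q) := by
    filter_upwards [hcne] with q hq
    exact det_one_sub_smul_dartWeight o u q hq
  have hD : meromorphicOrderAt (zetaDet G u) z = (((nE G : ℤ) - nV G + m : ℤ) : WithTop ℤ) := by
    rw [meromorphicOrderAt_congr hdet, meromorphicOrderAt_mul (hcA.meromorphicAt.zpow _)
      hBA.meromorphicAt, meromorphicOrderAt_zpow hcA.meromorphicAt, hc1, hB, mul_one,
      ← WithTop.coe_add]
  have hZ : Z =ᶠ[𝓝[≠] z] (zetaDet G u)⁻¹ :=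
    eventuallyEq_nhdsNE_of_eventuallyEq_nhds h.1 (isBartholdiZeta_inv_zetaDet u).1
      (h.eventuallyEq (isBartholdiZeta_inv_zetaDet u)) z
  rw [meromorphicOrderAt_congr hZ, meromorphicOrderAt_inv, hD]
  rfl

end ZetaFunction

/-! ### Reading poles off the order -/

section PoleOrders

theorem isPole_iff_of_order {Z : ℂ → ℂ} {z : ℂ} (hZ : MeromorphicAt Z z) {n : ℤ}
    (h : meromorphicOrderAt Z z = ((-n : ℤ) : WithTop ℤ)) : IsPole Z z ↔ 0 < n := by
  rw [IsPole, and_iff_right hZ, h, ← WithTop.coe_zero, WithTop.coe_lt_coe]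
  omega

theorem isPoleOfOrder_iff_of_order {Z : ℂ → ℂ} {z : ℂ} (hZ : MeromorphicAt Z z) {n k : ℤ}
    (h : meromorphicOrderAt Z z = ((-n : ℤ) : WithTop ℤ)) :
    IsPoleOfOrder Z z k ↔ 0 < n ∧ n = k := by
  rw [IsPoleOfOrder, isPole_iff_of_order hZ h, h, WithTop.coe_inj]
  omega

theorem isPoleOfOrderAtLeast_iff_of_order {Z : ℂ → ℂ} {z : ℂ} (hZ : MeromorphicAt Z z) {n k : ℤ}
    (h : meromorphicOrderAt Z z = ((-n : ℤ) : WithTop ℤ)) :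
    IsPoleOfOrderAtLeast Z z k ↔ 0 < n ∧ k ≤ n := by
  rw [IsPoleOfOrderAtLeast, isPole_iff_of_order hZ h, h, WithTop.coe_le_coe]
  omega

end PoleOrders

end BartholdiZeta

/-! ### Pole orders at -1/(1 - u) -/

theorem corollary4p17 {V : Type*} [Fintype V] [DecidableEq V]
    (G : SimpleGraph V) [DecidableRel G.Adj] (hG : G.Connected)
    (o : BartholdiZeta.EdgeDirection G) (u : ℂ) (hu : u ≠ 1) :
    (∃ Z : ℂ → ℂ, BartholdiZeta.IsBartholdiZeta G u Z) ∧
    ∀ Z : ℂ → ℂ, BartholdiZeta.IsBartholdiZeta G u Z →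
      -- non-bipartite graphs
      (¬ G.IsBipartite → BartholdiZeta.nV G < BartholdiZeta.nE G →
        BartholdiZeta.IsPoleOfOrder Z (-(1 - u)⁻¹)
          ((BartholdiZeta.nE G : ℤ) - BartholdiZeta.nV G)) ∧
      (¬ G.IsBipartite → BartholdiZeta.nE G = BartholdiZeta.nV G →
        ¬ BartholdiZeta.IsPole Z (-(1 - u)⁻¹)) ∧
      -- bipartite graphs: `ζ` is even in `q`, so its order at `±(1 - u)⁻¹` is the same
      (G.IsBipartite → (fun q => Z (-q)) =ᶠ[codiscrete ℂ] Z) ∧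
      (G.IsBipartite →
        meromorphicOrderAt Z (-(1 - u)⁻¹) = meromorphicOrderAt Z ((1 - u)⁻¹)) ∧
      -- bipartite graphs that are not trees
      (G.IsBipartite → ¬ G.IsTree →
        (u ≠ BartholdiZeta.uStar G →
          BartholdiZeta.IsPoleOfOrder Z (-(1 - u)⁻¹)
            ((BartholdiZeta.nE G : ℤ) - BartholdiZeta.nV G + 1)) ∧
        (BartholdiZeta.IsPoleOfOrderAtLeast Z (-(1 - u)⁻¹)
            ((BartholdiZeta.nE G : ℤ) - BartholdiZeta.nV G + 2) ↔
          u = BartholdiZeta.uStar G)) ∧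
      -- trees
      (G.IsTree →
        (BartholdiZeta.IsPole Z (-(1 - u)⁻¹) ↔ u = BartholdiZeta.uStar G)) ∧
      -- the exact order at `u = u_*`
      (G.IsBipartite → BartholdiZeta.normSqPinvDegree o ≠ (BartholdiZeta.nE G : ℝ) →
        u = BartholdiZeta.uStar G →
        BartholdiZeta.IsPoleOfOrder Z (-(1 - u)⁻¹)
          ((BartholdiZeta.nE G : ℤ) - BartholdiZeta.nV G + 2)) := by
  open BartholdiZeta in
  refine ⟨⟨_, isBartholdiZeta_inv_zetaDet u⟩, fun Z hZ => ?_⟩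
  have ht : (1 - u) ≠ 0 := sub_ne_zero.2 hu.symm
  have hmer : MeromorphicAt Z (-(1 - u)⁻¹) := hZ.1 _ (Set.mem_univ _)
  have hvert := nV_le_nE_add_one hG
  have htree := isTree_iff_nE_add_one_eq hG
  have hnonbip : ¬ G.IsBipartite → meromorphicOrderAt Z (-(1 - u)⁻¹) =
      ((-((nE G : ℤ) - nV G) : ℤ) : WithTop ℤ) := by
    intro hb
    obtain ⟨m, hm, hord⟩ := hZ.exists_meromorphicOrderAt_eq o (z := -(1 - u)⁻¹)
      (by rw [mul_neg, mul_inv_cancel₀ ht]; norm_num)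
    rw [(analyticAt_det_bassMatrix _ _).analyticOrderAt_eq_zero.2
      (det_bassMatrix_neg_inv_ne_zero hG hb ht)] at hm
    obtain rfl : m = 0 := by exact_mod_cast hm.symm
    simpa using hord
  -- In the bipartite case the order is computed at +1/t, where the Laplacian appears, and carried
  -- to -1/t by evenness.
  obtain ⟨m, hm, hord⟩ := hZ.exists_meromorphicOrderAt_eq o (z := (1 - u)⁻¹)
    (by rw [mul_inv_cancel₀ ht]; norm_num)
  have hm1 : u ≠ uStar G → m = 1 := by
    intro h
    rw [analyticOrderAt_det_bassMatrix_eq_one hG ht (mt (eq_uStar_iff hG u).2 h)] at hm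
    exact_mod_cast hm.symm
  have hm2 : u = uStar G → 2 ≤ m := by
    intro h
    have := two_le_analyticOrderAt_det_bassMatrix hG ht ((eq_uStar_iff hG u).1 h)
    rw [hm] at this
    exact_mod_cast this
  have hm3 : normSqPinvDegree o ≠ nE G → u = uStar G → m = 2 := by
    intro hne h
    rw [analyticOrderAt_det_bassMatrix_eq_two_of_normSq hG o ht ((eq_uStar_iff hG u).1 h) hne]
      at hm
    exact_mod_cast hm.symm
  have hbip : G.IsBipartite → meromorphicOrderAt Z (-(1 - u)⁻¹) =
      ((-((nE G : ℤ) - nV G + m) : ℤ) : WithTop ℤ) := fun hb =>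
    (hZ.meromorphicOrderAt_neg hb _).trans hord
  refine ⟨fun hb hlt => ?_, fun hb heq => ?_, fun hb => ?_, fun hb => ?_, fun hb hT => ⟨fun hne => ?_,
    ?_⟩, fun hT => ?_, fun hb hne heq => ?_⟩
  · rw [isPoleOfOrder_iff_of_order hmer (hnonbip hb)]
    omega
  · rw [isPole_iff_of_order hmer (hnonbip hb)]
    omega
  · exact eventuallyEq_codiscrete_of_eventuallyEq_nhds hZ.meromorphicOn_neg hZ.1
      (hZ.eventuallyEq_neg hb)
  · exact hZ.meromorphicOrderAt_neg hb _
  · rw [isPoleOfOrder_iff_of_order hmer (hbip hb)]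
    rw [htree] at hT
    have := hm1 hne
    omega
  · rw [isPoleOfOrderAtLeast_iff_of_order hmer (hbip hb)]
    rw [htree] at hT
    by_cases h : u = uStar G
    · have := hm2 h
      simp only [h, iff_true]
      omega
    · have := hm1 h
      simp only [h, iff_false]
      omega
  -- For a tree n_E - n_V + m = m - 1, which is positive exactly when m ≥ 2.
  · rw [isPole_iff_of_order hmer (hbip hT.isBipartite)]
    rw [htree] at hT
    by_cases h : u = uStar G
    · have := hm2 h
      simp only [h, iff_true]
      omega
    · have := hm1 h
      simp only [h, iff_false]
      omega
  · rw [isPoleOfOrder_iff_of_order hmer (hbip hb)]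
    have := hm3 hne heq
    omega
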